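/- Let $H$ be a real Hilbert space, $\beta>0$, $\rho\in(0,2\beta)$. Let $f:H\to\mathbb R$ be convex and differentiable with $\frac1\beta$-Lipschitz gradient, let $g:H\to(-\infty,+\infty]$ be proper, convex and lower semicontinuous, and suppose $\Omega:=\operatorname{Argmin}(f+g)\neq\varnothing$. Put $\operatorname{prox}_{\rho g}(u)=\arg\min_x\{\frac1{2\rho}\|x-u\|^2+g(x)\}$ and $T:=\operatorname{prox}_{\rho g}\circ(I-\rho\nabla f)$. For arbitrary $z^{-1},z^0\in H$ let $$\mu^k=z^k+\alpha_k(z^k-z^{k-1}),\qquad z^{k+1}=\mu^k+\lambda_k\big(\operatorname{prox}_{\rho g}(\mu^k-\rho(\nabla f(\mu^k)+e^{1,k}))+e^{2,k}-\mu^k\big)\qquad(k\ge 0).$$ Assume that $\{z^k\}_{k\ge0}$ is bounded, that $0\le\alpha_k\le\alpha<1$ for all $k$, and that one of the following holds for some $\lambda>0$. (I) $\lambda\le\lambda_k\le\lambda'<\frac{4\beta-\rho}{2\beta}$ for all $k$, and $\sum_{k\ge0}\alpha_k\|z^k-z^{k-1}\|^2<\infty$, $\sum_{k\ge0}\lambda_k\|e^{1,k}\|<\infty$,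 $\sum_{k\ge0}\lambda_k\|e^{2,k}\|<\infty$. In this case put $\theta:=\lambda'$. (II) $\alpha_0=0$, $\{\alpha_k\}$ is nondecreasing, $\sum_{k\ge0}\|e^{1,k}\|<\infty$, $\sum_{k\ge0}\|e^{2,k}\|<\infty$, and there are $\sigma,\delta>0$ with $$\delta>\frac{\alpha[\alpha(1+\alpha)+\sigma]}{1-\alpha^2},\qquad \lambda\le\lambda_k\le\overline\lambda:=\frac{4\beta-\rho}{2\beta}\cdot\frac{\delta-\alpha[\alpha(1+\alpha)+\alpha\delta+\sigma]}{\delta[1+\alpha(1+\alpha)+\alpha\delta+\sigma]}\quad\text{for all }k.$$ In this case put $\theta:=\overline\lambda$. Then: (i) $\lim_{k\to\infty}\|z^k-z^*\|$ exists for every $z^*\in\Omega$; (ii) $\{z^k\}$ converges weakly to a point of $\Omega$; (iii) $\theta<\frac{4\beta-\rho}{2\beta}$, and for every $z^*\in\Omega$ and every $k\ge1$ $$\min_{1\le i\le k}\|T\mu^i-\mu^i\|^2\le\frac{1}{k\,\lambda\left(\frac{4\beta-\rho}{2\beta}-\theta\right)}\left(\|z^1-z^*\|^2+\Delta\right),$$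 where, with $e^k:=\operatorname{prox}_{\rho g}(\mu^k-\rho(\nabla f(\mu^k)+e^{1,k}))+e^{2,k}-T\mu^k$ and $[t]_+=\max\{t,0\}$, $$\Delta=\alpha\sum_{k\ge1}\big[\|z^k-z^*\|^2-\|z^{k-1}-z^*\|^2\big]_+ +\sum_{k\ge1}2\|z^{k+1}-z^*\|\lambda_k\|e^k\|+\sum_{k\ge1}\alpha_k(1+\alpha_k)\|z^k-z^{k-1}\|^2,$$ and each of these three series converges, so $\Delta<\infty$. -/

import Mathlib

open Filter Topology Gradient

noncomputable section

namespace InertialFB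

variable {H : Type*} [NormedAddCommGroup H] [InnerProductSpace ℝ H]

/-- Properness of `g : H → (-∞, +∞]`: never `-∞`, and finite somewhere. -/
def IsProper (g : H → EReal) : Prop :=
  (∀ x, g x ≠ ⊥) ∧ ∃ x, g x ≠ ⊤

/-- Convexity of an extended-real-valued function. -/
def IsConvex (g : H → EReal) : Prop :=
  ∀ x y : H, ∀ a b : ℝ, 0 < a → 0 < b → a + b = 1 →
    g (a • x + b • y) ≤ (a : EReal) * g x + (b : EReal) * g y

/-- The set of global minimizers of an extended-real-valued function. -/
def argmin (F : H → EReal) : Set H :=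
  {x | ∀ y, F x ≤ F y}

/-- The objective function `f + g`. -/
def objective (f : H → ℝ) (g : H → EReal) (x : H) : EReal :=
  (f x : EReal) + g x

/-- The proximity operator `prox_{γ g}(u) = argmin_x { (1 / (2γ)) ‖x - u‖² + g x }`.
For `γ > 0` and `g` proper, convex and lower semicontinuous the minimizer exists and is unique. -/
def prox (γ : ℝ) (g : H → EReal) (u : H) : H :=
  Classical.epsilon fun p =>
    p ∈ argmin fun x => ((1 / (2 * γ) * ‖x - u‖ ^ 2 : ℝ) : EReal) + g x

variable [CompleteSpace H]

/-- The forward-backward operator `T = prox_{ρ g} ∘ (I - ρ ∇f)`. -/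
def fbOp (ρ : ℝ) (f : H → ℝ) (g : H → EReal) (u : H) : H :=
  prox ρ g (u - ρ • ∇ f u)

/-- The inexact inertial proximal-gradient scheme. The iterates `z` are indexed by integers so that
`z (-1)` and `z 0` are the (arbitrary) starting points; the other sequences start at `0`. -/
structure IsScheme (ρ : ℝ) (f : H → ℝ) (g : H → EReal) (α lam : ℕ → ℝ) (e₁ e₂ : ℕ → H)
    (z : ℤ → H) (μ : ℕ → H) : Prop where
  inertial : ∀ k : ℕ, μ k = z k + α k • (z k - z (k - 1))
  step : ∀ k : ℕ, z (k + 1) =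
    μ k + lam k • (prox ρ g (μ k - ρ • (∇ f (μ k) + e₁ k)) + e₂ k - μ k)

/-- The first set of conditions on the parameters and errors, with `a` the upper bound of the
inertial parameters and `lamLow`, `lamUp` the bounds of the relaxation parameters. -/
structure ConditionI (β ρ : ℝ) (α lam : ℕ → ℝ) (e₁ e₂ : ℕ → H) (z : ℤ → H)
    (a lamLow lamUp : ℝ) : Prop where
  inertia_bounds : ∀ k, 0 ≤ α k ∧ α k ≤ a
  a_lt_one : a < 1
  lamLow_pos : 0 < lamLow
  relax_bounds : ∀ k, lamLow ≤ lam k ∧ lam k ≤ lamUp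
  lamUp_lt : lamUp < (4 * β - ρ) / (2 * β)
  summable_inertia : Summable fun k : ℕ => α k * ‖z k - z (k - 1)‖ ^ 2
  summable_e₁ : Summable fun k => lam k * ‖e₁ k‖
  summable_e₂ : Summable fun k => lam k * ‖e₂ k‖
  bounded : Bornology.IsBounded (Set.range fun k : ℕ => z k)

/-- The upper bound of the relaxation parameters in the second set of conditions. -/
def lamBar (β ρ a σ δ : ℝ) : ℝ :=
  (4 * β - ρ) / (2 * β) *
    ((δ - a * (a * (1 + a) + a * δ + σ)) / (δ * (1 + a * (1 + a) + a * δ + σ)))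

/-- The second set of conditions on the parameters and errors. -/
structure ConditionII (β ρ : ℝ) (α lam : ℕ → ℝ) (e₁ e₂ : ℕ → H) (z : ℤ → H)
    (a lamLow σ δ : ℝ) : Prop where
  inertia_bounds : ∀ k, 0 ≤ α k ∧ α k ≤ a
  a_lt_one : a < 1
  inertia_zero : α 0 = 0
  inertia_mono : Monotone α
  σ_pos : 0 < σ
  δ_pos : 0 < δ
  δ_gt : a * (a * (1 + a) + σ) / (1 - a ^ 2) < δ
  lamLow_pos : 0 < lamLow
  relax_bounds : ∀ k, lamLow ≤ lam k ∧ lam k ≤ lamBar β ρ a σ δ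
  summable_e₁ : Summable fun k => ‖e₁ k‖
  summable_e₂ : Summable fun k => ‖e₂ k‖
  bounded : Bornology.IsBounded (Set.range fun k : ℕ => z k)

/-- The total error `e k` committed in step `k` in evaluating `T (μ k)`, so that
`z (k + 1) = μ k + lam k • (T (μ k) + e k - μ k)`. -/
def totalError (ρ : ℝ) (f : H → ℝ) (g : H → EReal) (e₁ e₂ : ℕ → H) (μ : ℕ → H) (k : ℕ) : H :=
  prox ρ g (μ k - ρ • (∇ f (μ k) + e₁ k)) + e₂ k - fbOp ρ f g (μ k)

/-- `k`-th term of the first series in `Δ`: `[‖z k - z*‖² - ‖z (k-1) - z*‖²]₊`. -/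
def incrTerm (z : ℤ → H) (zs : H) (k : ℕ) : ℝ :=
  max (‖z k - zs‖ ^ 2 - ‖z (k - 1) - zs‖ ^ 2) 0

/-- `k`-th term of the second series in `Δ`: `2 ‖z (k+1) - z*‖ * lam k * ‖e k‖`. -/
def errTerm (lam : ℕ → ℝ) (e : ℕ → H) (z : ℤ → H) (zs : H) (k : ℕ) : ℝ :=
  2 * ‖z (k + 1) - zs‖ * lam k * ‖e k‖

/-- `k`-th term of the third series in `Δ`: `α k * (1 + α k) * ‖z k - z (k-1)‖²`. -/
def inertiaTerm (α : ℕ → ℝ) (z : ℤ → H) (k : ℕ) : ℝ :=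
  α k * (1 + α k) * ‖z k - z (k - 1)‖ ^ 2

/-- The constant `Δ`; each of the three series runs over `k ≥ 1`. -/
def Delta (a : ℝ) (α lam : ℕ → ℝ) (e : ℕ → H) (z : ℤ → H) (zs : H) : ℝ :=
  a * (∑' k : ℕ, incrTerm z zs (k + 1)) + (∑' k : ℕ, errTerm lam e z zs (k + 1))
    + ∑' k : ℕ, inertiaTerm α z (k + 1)

end InertialFB

end

/-!
The gradient `∇ f` is `β`-cocoercive (Baillon–Haddad) and the proximal map is firmly nonexpansive.
Hence, with `κ = (4 * β - ρ) / (2 * β)`, the operator `I - T` is `κ / 2`-cocoercive. So `T` is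
averaged with constant `1 / κ`, and its fixed points are the minimizers of `f + g`.

The scheme is then an inertial Krasnoselskii–Mann iteration of `T` perturbed by `λ k * e k`. For a
fixed point `s`, expanding `‖z (k + 1) - s‖ ^ 2` gives
`φ (k + 1) - φ k ≤ α k * (φ k - φ (k - 1)) + ε k - λ k * (κ - λ k) * ‖T (μ k) - μ k‖ ^ 2`
for `φ k = ‖z k - s‖ ^ 2` and a summable perturbation `ε`. Since `α k ≤ α < 1`, the positive parts
of `φ (k + 1) - φ k` are summable, so `φ` converges, and summing the inequality bounds the
residuals. They tend to zero, so weak cluster points are fixed points (demiclosedness), and Opial's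
lemma gives weak convergence.

Case (II) provides the summability of `α k * ‖z k - z (k - 1)‖ ^ 2` that case (I) assumes: the bound
on `λ k` makes a Lyapunov function decrease, up to summable errors, by a multiple of
`‖z (k + 1) - z k‖ ^ 2`.
-/

namespace InertialFB

open scoped InnerProductSpace

section Cocoercive

variable {H : Type*} [NormedAddCommGroup H] [InnerProductSpace ℝ H] {c : ℝ}

/-- A `c`-cocoercive operator. In terms of cocoercivity, `A` is firmly nonexpansive iff it is
`1`-cocoercive, and `T` is averaged with constant `1 / κ` iff `I - T` is `κ / 2`-cocoercive. -/
def IsCocoercive (c : ℝ) (A : H → H) : Prop :=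
  ∀ x y, c * ‖A x - A y‖ ^ 2 ≤ ⟪A x - A y, x - y⟫_ℝ

lemma IsCocoercive.mul_norm_sub_le {A : H → H} (hA : IsCocoercive c A) (x y : H) :
    c * ‖A x - A y‖ ≤ ‖x - y‖ := by
  rcases (norm_nonneg (A x - A y)).eq_or_lt with hzero | hpos
  · rw [← hzero, mul_zero]
    exact norm_nonneg _
  · refine le_of_mul_le_mul_left ?_ hpos
    calc ‖A x - A y‖ * (c * ‖A x - A y‖) = c * ‖A x - A y‖ ^ 2 := by ring
      _ ≤ ⟪A x - A y, x - y⟫_ℝ := hA x y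
      _ ≤ ‖A x - A y‖ * ‖x - y‖ := real_inner_le_norm _ _

lemma IsCocoercive.lipschitzWith_one {T : H → H} (hT : IsCocoercive c fun x => x - T x)
    (hc : 1 / 2 ≤ c) : LipschitzWith 1 T := by
  refine LipschitzWith.mk_one fun x y => ?_
  rw [dist_eq_norm, dist_eq_norm]
  refine le_of_sq_le_sq ?_ (norm_nonneg _)
  have hcoc : c * ‖x - T x - (y - T y)‖ ^ 2 ≤ ⟪x - T x - (y - T y), x - y⟫_ℝ := hT x y
  have hTxy : T x - T y = (x - y) - (x - T x - (y - T y)) := by abel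
  rw [hTxy, norm_sub_sq_real, real_inner_comm]
  nlinarith [sq_nonneg ‖x - T x - (y - T y)‖]

lemma IsCocoercive.forwardBackward {P B : H → H} {β ρ : ℝ} (hP : IsCocoercive 1 P)
    (hB : IsCocoercive β B) (hβ : 0 < β) (hρ : 0 ≤ ρ) :
    IsCocoercive ((4 * β - ρ) / (4 * β)) fun x => x - P (x - ρ • B x) := by
  have hexpand (u r d : H) : ⟪u - r, r - ρ • d⟫_ℝ
      = ⟪r, u⟫_ℝ - ρ * ⟪d, u⟫_ℝ - ‖r‖ ^ 2 + ρ * ⟪r, d⟫_ℝ := by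
    rw [inner_sub_left, inner_sub_right, inner_sub_right, inner_smul_right, inner_smul_right,
      real_inner_self_eq_norm_sq, real_inner_comm r, real_inner_comm d u]
    ring
  have hyoung (r d : H) : 0 ≤ β * ‖d‖ ^ 2 - ⟪r, d⟫_ℝ + ‖r‖ ^ 2 / (4 * β) := by
    have hsq : β * ‖d‖ ^ 2 - ⟪r, d⟫_ℝ + ‖r‖ ^ 2 / (4 * β) = ‖r - (2 * β) • d‖ ^ 2 / (4 * β) := by
      rw [norm_sub_sq_real, inner_smul_right, norm_smul, mul_pow, Real.norm_eq_abs, sq_abs]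
      field_simp
      ring
    rw [hsq]
    positivity
  intro x y
  set r := x - P (x - ρ • B x) - (y - P (y - ρ • B y)) with hr
  set d := B x - B y
  have hfirm : 0 ≤ ⟪(x - y) - r, r - ρ • d⟫_ℝ := by
    have hPxy := hP (x - ρ • B x) (y - ρ • B y)
    have hP' : P (x - ρ • B x) - P (y - ρ • B y) = (x - y) - r := by rw [hr]; abel
    have harg : x - ρ • B x - (y - ρ • B y) = ((x - y) - r) + (r - ρ • d) := by
      rw [smul_sub]; abel
    rw [hP', harg, inner_add_right, real_inner_self_eq_norm_sq] at hPxy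
    linarith
  have hcoc : ρ * (β * ‖d‖ ^ 2) ≤ ρ * ⟪d, x - y⟫_ℝ := mul_le_mul_of_nonneg_left (hB x y) hρ
  have hsplit : (4 * β - ρ) / (4 * β) * ‖r‖ ^ 2 = ‖r‖ ^ 2 - ρ * (‖r‖ ^ 2 / (4 * β)) := by
    field_simp
  rw [hexpand] at hfirm
  linarith [mul_nonneg hρ (hyoung r d)]

/-- `T` is averaged with constant `1 / κ` relative to the point `s`, i.e.
`‖T x - s‖ ^ 2 ≤ ‖x - s‖ ^ 2 - (κ - 1) * ‖T x - x‖ ^ 2` with the norm on the left expanded. -/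
def IsQuasiAveragedAt (κ : ℝ) (T : H → H) (s : H) : Prop :=
  ∀ x, κ * ‖T x - x‖ ^ 2 ≤ 2 * ⟪x - T x, x - s⟫_ℝ

lemma IsCocoercive.isQuasiAveragedAt {T : H → H} {s : H}
    (hT : IsCocoercive c fun x => x - T x) (hs : T s = s) :
    IsQuasiAveragedAt (2 * c) T s := fun x => by
  have hcoc : c * ‖x - T x - (s - T s)‖ ^ 2 ≤ ⟪x - T x - (s - T s), x - s⟫_ℝ := hT x s
  rw [hs, sub_self, sub_zero] at hcoc
  rw [norm_sub_rev]
  linarith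

end Cocoercive

section SmoothConvex

variable {H : Type*} [NormedAddCommGroup H] [InnerProductSpace ℝ H] [CompleteSpace H]
  {f : H → ℝ}

lemma hasDerivAt_comp_lineMap {v x y : H} {t : ℝ}
    (hv : HasGradientAt f v (AffineMap.lineMap x y t)) :
    HasDerivAt (fun s : ℝ => f (AffineMap.lineMap x y s)) ⟪v, y - x⟫_ℝ t :=
  (hv.hasFDerivAt.comp_hasDerivAt t AffineMap.hasDerivAt_lineMap).congr_deriv (by simp)

lemma add_inner_le_of_convexOn (hf : ConvexOn ℝ Set.univ f) {v x : H}
    (hv : HasGradientAt f v x) (y : H) : f x + ⟪v, y - x⟫_ℝ ≤ f y := by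
  have hline : ConvexOn ℝ Set.univ fun s : ℝ => f (AffineMap.lineMap x y s) :=
    hf.comp_affineMap (AffineMap.lineMap x y)
  have hderiv : HasDerivAt (fun s : ℝ => f (AffineMap.lineMap x y s)) ⟪v, y - x⟫_ℝ 0 :=
    hasDerivAt_comp_lineMap (by simpa using hv)
  have hslope := hline.le_slope_of_hasDerivAt (Set.mem_univ 0) (Set.mem_univ 1) one_pos hderiv
  simp only [slope_def_field, AffineMap.lineMap_apply_one, AffineMap.lineMap_apply_zero, sub_zero,
    div_one] at hslope
  linarith

lemma le_add_inner_add_sq {L : ℝ} (hf : Differentiable ℝ f)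
    (hL : ∀ x y, ‖∇ f x - ∇ f y‖ ≤ L * ‖x - y‖) (x y : H) :
    f y ≤ f x + ⟪∇ f x, y - x⟫_ℝ + L / 2 * ‖y - x‖ ^ 2 := by
  have hderiv (t : ℝ) : HasDerivAt (fun s : ℝ => f (AffineMap.lineMap x y s))
      ⟪∇ f (AffineMap.lineMap x y t), y - x⟫_ℝ t :=
    hasDerivAt_comp_lineMap (hf _).hasGradientAt
  have hquad (t : ℝ) : HasDerivAt
      (fun s : ℝ => f x + s * ⟪∇ f x, y - x⟫_ℝ + L / 2 * ‖y - x‖ ^ 2 * s ^ 2)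
      (⟪∇ f x, y - x⟫_ℝ + L * ‖y - x‖ ^ 2 * t) t := by
    refine ((((hasDerivAt_id t).mul_const _).const_add _).add
      ((hasDerivAt_pow 2 t).const_mul _)).congr_deriv ?_
    simp only [Nat.cast_ofNat]
    ring
  have hbound (t : ℝ) (ht : t ∈ Set.Ico (0 : ℝ) 1) : ⟪∇ f (AffineMap.lineMap x y t), y - x⟫_ℝ
      ≤ ⟪∇ f x, y - x⟫_ℝ + L * ‖y - x‖ ^ 2 * t := by
    have hgrad := hL (AffineMap.lineMap x y t) x
    rw [← dist_eq_norm (AffineMap.lineMap x y t), dist_lineMap_left, Real.norm_of_nonneg ht.1,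
      dist_comm, dist_eq_norm] at hgrad
    calc _ = ⟪∇ f x, y - x⟫_ℝ + ⟪∇ f (AffineMap.lineMap x y t) - ∇ f x, y - x⟫_ℝ := by
          rw [inner_sub_left]; ring
      _ ≤ ⟪∇ f x, y - x⟫_ℝ + L * (t * ‖y - x‖) * ‖y - x‖ := by
          gcongr
          exact (real_inner_le_norm _ _).trans (by gcongr)
      _ = _ := by ring
  have h := image_le_of_deriv_right_le_deriv_boundary
    (HasDerivAt.continuousOn fun t _ => hderiv t) (fun t _ => (hderiv t).hasDerivWithinAt)
    (by simp) (HasDerivAt.continuousOn fun t _ => hquad t)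
    (fun t _ => (hquad t).hasDerivWithinAt) hbound (Set.right_mem_Icc.2 zero_le_one)
  simpa using h

/-- The Baillon–Haddad theorem. -/
lemma isCocoercive_gradient (hconv : ConvexOn ℝ Set.univ f) (hf : Differentiable ℝ f)
    {β : ℝ} (hβ : 0 < β) (hL : ∀ x y, ‖∇ f x - ∇ f y‖ ≤ 1 / β * ‖x - y‖) :
    IsCocoercive β (∇ f) := by
  have hgap (x y : H) : f x + ⟪∇ f x, y - x⟫_ℝ + β / 2 * ‖∇ f x - ∇ f y‖ ^ 2 ≤ f y := by
    set w := ∇ f x - ∇ f y with hw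
    -- One gradient step of length `β` from `y` for `f - ⟪∇ f x, ·⟫`, which is minimal at `x`.
    have hlower := add_inner_le_of_convexOn hconv (hf x).hasGradientAt (y + β • w)
    have hupper := le_add_inner_add_sq hf hL y (y + β • w)
    rw [add_sub_right_comm, inner_add_right, inner_smul_right] at hlower
    rw [add_sub_cancel_left, inner_smul_right, norm_smul, Real.norm_of_nonneg hβ.le] at hupper
    have hww : ⟪∇ f x, w⟫_ℝ - ⟪∇ f y, w⟫_ℝ = ‖w‖ ^ 2 := by
      rw [← inner_sub_left, ← hw, real_inner_self_eq_norm_sq]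
    have hstep : β * ⟪∇ f x, w⟫_ℝ - β * ⟪∇ f y, w⟫_ℝ = β * ‖w‖ ^ 2 := by rw [← hww]; ring
    have hquad : 1 / β / 2 * (β * ‖w‖) ^ 2 = β / 2 * ‖w‖ ^ 2 := by field_simp
    linarith
  intro x y
  have hinner : ⟪∇ f x - ∇ f y, x - y⟫_ℝ = -⟪∇ f x, y - x⟫_ℝ - ⟪∇ f y, x - y⟫_ℝ := by
    rw [inner_sub_left, ← neg_sub y x, inner_neg_right (∇ f x)]
  have hyx := hgap y x
  rw [norm_sub_rev (∇ f y)] at hyx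
  linarith [hgap x y]

end SmoothConvex

section Prox

variable {H : Type*} [NormedAddCommGroup H] [InnerProductSpace ℝ H] {g : H → EReal} {γ : ℝ}

/-- `v` is a subgradient of `g` at `p`, where `g p` is required to be finite. -/
def IsSubgradient (g : H → EReal) (p v : H) : Prop :=
  ∃ c : ℝ, g p = c ∧ ∀ y, ((c + ⟪v, y - p⟫_ℝ : ℝ) : EReal) ≤ g y

lemma IsSubgradient.monotone {p q v w : H} (hp : IsSubgradient g p v)
    (hq : IsSubgradient g q w) : 0 ≤ ⟪p - q, v - w⟫_ℝ := by
  obtain ⟨c, hc, hsub_p⟩ := hp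
  obtain ⟨d, hd, hsub_q⟩ := hq
  have hpq : c + ⟪v, q - p⟫_ℝ ≤ d := by exact_mod_cast hd ▸ hsub_p q
  have hqp : d + ⟪w, p - q⟫_ℝ ≤ c := by exact_mod_cast hc ▸ hsub_q p
  have hinner : ⟪p - q, v - w⟫_ℝ = -⟪v, q - p⟫_ℝ - ⟪w, p - q⟫_ℝ := by
    rw [real_inner_comm, inner_sub_left, ← neg_sub q p, inner_neg_right v]
  linarith

lemma IsSubgradient.mem_argmin {h : H → ℝ} {p v : H} (hp : IsSubgradient g p (-v))
    (hh : ∀ y, h p + ⟪v, y - p⟫_ℝ ≤ h y) : p ∈ argmin (objective h g) := by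
  obtain ⟨c, hc, hsub⟩ := hp
  intro y
  calc objective h g p = ((h p + c : ℝ) : EReal) := by rw [objective, hc, EReal.coe_add]
    _ ≤ ((h y + (c + ⟪-v, y - p⟫_ℝ) : ℝ) : EReal) := by
        rw [EReal.coe_le_coe_iff, inner_neg_left]
        linarith [hh y]
    _ ≤ objective h g y := by
        rw [EReal.coe_add]
        exact add_le_add_right (hsub y) _

lemma IsConvex.le_of_le (hg : IsConvex g) {x y : H} {a b c d : ℝ} (hc : g x ≤ c) (hd : g y ≤ d)
    (ha : 0 < a) (hb : 0 < b) (hab : a + b = 1) :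
    g (a • x + b • y) ≤ ((a * c + b * d : ℝ) : EReal) := by
  refine (hg x y a b ha hb hab).trans ?_
  rw [EReal.coe_add, EReal.coe_mul, EReal.coe_mul]
  exact add_le_add (mul_le_mul_of_nonneg_left hc (EReal.coe_nonneg.2 ha.le))
    (mul_le_mul_of_nonneg_left hd (EReal.coe_nonneg.2 hb.le))

lemma objective_le_coe_iff {X : Type*} {h : X → ℝ} {g : X → EReal} {x : X} {r : ℝ} :
    objective h g x ≤ r ↔ g x ≤ ((r - h x : ℝ) : EReal) := by
  rw [objective, EReal.coe_sub, EReal.le_sub_iff_add_le (.inl (EReal.coe_ne_bot _))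
    (.inl (EReal.coe_ne_top _)), add_comm]

lemma exists_eq_coe_of_mem_argmin {X : Type*} {h : X → ℝ} {g : X → EReal} {p : X}
    (hg : IsProper g) (hp : p ∈ argmin (objective h g)) : ∃ c : ℝ, g p = c := by
  obtain ⟨hbot, x, hx⟩ := hg
  lift g x to ℝ using ⟨hx, hbot x⟩ with d hd
  have hle : g p ≤ ((h x + d - h p : ℝ) : EReal) :=
    objective_le_coe_iff.1 ((hp x).trans_eq (by rw [objective, ← hd, EReal.coe_add]))
  exact ⟨_, (EReal.coe_toReal (ne_top_of_le_ne_top (EReal.coe_ne_top _) hle) (hbot p)).symm⟩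

/-- Fermat's rule for the sum of a differentiable and a convex function. -/
lemma isSubgradient_of_mem_argmin [CompleteSpace H] (hg : IsProper g) (hconv : IsConvex g)
    {h : H → ℝ} {p v : H} (hh : HasGradientAt h v p) (hp : p ∈ argmin (objective h g)) :
    IsSubgradient g p (-v) := by
  obtain ⟨c, hc⟩ := exists_eq_coe_of_mem_argmin hg hp
  refine ⟨c, hc, fun y => EReal.le_of_forall_lt_iff_le.1 fun d hd => ?_⟩
  have hlim := (hasDerivAt_comp_lineMap (y := y) (t := 0)
    (by simpa using hh)).tendsto_slope_zero_right
  have hslope : ∀ᶠ t : ℝ in 𝓝[>] 0, c - d ≤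
      t⁻¹ • (h (AffineMap.lineMap p y (0 + t)) - h (AffineMap.lineMap p y (0 : ℝ))) := by
    filter_upwards [Ioo_mem_nhdsGT (zero_lt_one' ℝ)] with t ht
    have hgt := hconv.le_of_le hc.le hd.le (sub_pos.2 ht.2) ht.1 (by ring)
    rw [← AffineMap.lineMap_apply_module] at hgt
    have hmin : h p + c ≤
        h (AffineMap.lineMap p y t) + ((1 - t) * c + t * d) := by
      have hle := hp (AffineMap.lineMap p y t)
      rw [objective, hc, objective] at hle
      exact_mod_cast hle.trans (add_le_add_right hgt _)
    rw [zero_add, AffineMap.lineMap_apply_zero, smul_eq_mul, le_inv_mul_iff₀ ht.1]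
    linarith
  have hle := ge_of_tendsto hlim hslope
  rw [EReal.coe_le_coe_iff, inner_neg_left]
  linarith

lemma exists_sub_mul_norm_le (hg : IsProper g) (hconv : IsConvex g)
    (hlsc : LowerSemicontinuous g) :
    ∃ m L : ℝ, 0 ≤ L ∧ ∀ y, ((m - L * ‖y‖ : ℝ) : EReal) ≤ g y := by
  obtain ⟨hbot, x, hx⟩ := hg
  lift g x to ℝ using ⟨hx, hbot x⟩ with c hc
  have hnear : ∀ᶠ w in 𝓝 x, ((c - 1 : ℝ) : EReal) < g w :=
    hlsc x _ (hc.subst (motive := (_ < ·)) (EReal.coe_lt_coe_iff.2 (sub_one_lt c)))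
  obtain ⟨r, hr, hball⟩ := Metric.eventually_nhds_iff.1 hnear
  refine ⟨c - 2 - ‖x‖ / r, 1 / r, by positivity, fun y => ?_⟩
  refine EReal.le_of_forall_lt_iff_le.1 fun d hd => ?_
  -- A point of the segment from `x` to `y` that lies in the ball around `x`.
  set t := r / (2 * r + ‖y - x‖) with ht
  have hden : 0 < 2 * r + ‖y - x‖ := by positivity
  have ht_pos : 0 < t := by positivity
  have ht_lt : t < 1 := by rw [ht, div_lt_one hden]; linarith [norm_nonneg (y - x)]
  have hdist : dist (AffineMap.lineMap x y t) x < r := by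
    rw [dist_lineMap_left, Real.norm_of_nonneg ht_pos.le, dist_comm, dist_eq_norm, ht,
      div_mul_eq_mul_div, div_lt_iff₀ hden]
    nlinarith
  have hle := hconv.le_of_le hc.ge hd.le (sub_pos.2 ht_lt) ht_pos (by ring)
  rw [← AffineMap.lineMap_apply_module] at hle
  have hlt : c - 1 < (1 - t) * c + t * d := by exact_mod_cast (hball hdist).trans_le hle
  have hinv : 1 / t = 2 + ‖y - x‖ / r := by rw [ht]; field_simp
  have hdrop : c - 1 / t < d := by
    rw [sub_lt_comm, lt_div_iff₀ ht_pos]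
    linarith
  have htri : ‖y - x‖ / r ≤ ‖y‖ / r + ‖x‖ / r := by
    rw [← add_div]; gcongr; exact norm_sub_le y x
  rw [EReal.coe_le_coe_iff, one_div_mul_eq_div]
  linarith

lemma cauchySeq_of_sq_dist_le_add {X : Type*} [PseudoMetricSpace X] {x : ℕ → X} {ε : ℕ → ℝ}
    (hε : Tendsto ε atTop (𝓝 0)) (hx : ∀ k n, dist (x k) (x n) ^ 2 ≤ ε k + ε n) :
    CauchySeq x := by
  refine Metric.cauchySeq_iff.2 fun δ hδ => ?_
  obtain ⟨N, hN⟩ := eventually_atTop.1 (hε.eventually_lt_const (show 0 < δ ^ 2 / 2 by positivity))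
  refine ⟨N, fun k hk n hn => lt_of_pow_lt_pow_left₀ 2 hδ.le ?_⟩
  linarith [hx k n, hN k hk, hN n hn]

lemma exists_mem_argmin_of_midpoint_le [CompleteSpace H] {F : H → EReal} {κ m : ℝ} (hκ : 0 < κ)
    (hlsc : LowerSemicontinuous F) (hfin : ∃ x, F x ≠ ⊤) (hbdd : ∀ x, (m : EReal) ≤ F x)
    (hmid : ∀ x y, ∀ r s : ℝ, F x ≤ r → F y ≤ s →
      F ((1 / 2 : ℝ) • x + (1 / 2 : ℝ) • y) ≤ (((r + s) / 2 - κ * ‖x - y‖ ^ 2 : ℝ) : EReal)) :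
    ∃ p, p ∈ argmin F := by
  obtain ⟨x₀, hx₀⟩ := hfin
  obtain ⟨I, hI⟩ : ∃ I : ℝ, (I : EReal) = ⨅ x, F x :=
    ⟨_, EReal.coe_toReal (ne_top_of_le_ne_top hx₀ (iInf_le F x₀))
      (ne_bot_of_le_ne_bot (EReal.coe_ne_bot m) (le_iInf hbdd))⟩
  have hinf (y : H) : (I : EReal) ≤ F y := hI ▸ iInf_le F y
  have happrox (n : ℕ) : ∃ x, F x < ((I + 1 / ((n : ℝ) + 1) : ℝ) : EReal) := by
    refine iInf_lt_iff.1 (hI ▸ EReal.coe_lt_coe_iff.2 (lt_add_of_pos_right I ?_))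
    positivity
  choose x hx using happrox
  have hpair (k n : ℕ) :
      κ * ‖x k - x n‖ ^ 2 ≤ (1 / ((k : ℝ) + 1) + 1 / ((n : ℝ) + 1)) / 2 := by
    have hle := EReal.coe_le_coe_iff.1 ((hinf _).trans (hmid _ _ _ _ (hx k).le (hx n).le))
    linarith
  have hcauchy : CauchySeq x := by
    refine cauchySeq_of_sq_dist_le_add (ε := fun n : ℕ => 1 / ((n : ℝ) + 1) / (2 * κ)) ?_ ?_
    · simpa using tendsto_one_div_add_atTop_nhds_zero_nat.div_const (2 * κ)
    · intro k n
      rw [dist_eq_norm, ← add_div, le_div_iff₀ (by positivity)]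
      linarith [hpair k n]
  obtain ⟨p, hp⟩ := cauchySeq_tendsto_of_complete hcauchy
  have hlim : Tendsto (fun n : ℕ => I + 1 / ((n : ℝ) + 1)) atTop (𝓝 I) := by
    simpa using tendsto_one_div_add_atTop_nhds_zero_nat.const_add I
  have hpI : F p ≤ I := EReal.le_of_forall_lt_iff_le.1 fun r hr => by
    refine (hlsc.isClosed_preimage (r : EReal)).mem_of_tendsto hp ?_
    filter_upwards [hlim.eventually_lt_const (EReal.coe_lt_coe_iff.1 hr)] with n hn
    exact (hx n).le.trans (EReal.coe_le_coe_iff.2 hn.le)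
  exact ⟨p, fun y => hpI.trans (hinf y)⟩

lemma sq_dist_midpoint (s : ℝ) (u x y : H) :
    s * ‖(1 / 2 : ℝ) • x + (1 / 2 : ℝ) • y - u‖ ^ 2
      = (s * ‖x - u‖ ^ 2 + s * ‖y - u‖ ^ 2) / 2 - s / 4 * ‖x - y‖ ^ 2 := by
  have hmid : (1 / 2 : ℝ) • x + (1 / 2 : ℝ) • y - u
      = (1 / 2 : ℝ) • ((x - u) + (y - u)) := by module
  have hpar := parallelogram_law_with_norm ℝ (x - u) (y - u)
  rw [sub_sub_sub_cancel_right] at hpar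
  rw [hmid, norm_smul, mul_pow, Real.norm_of_nonneg one_half_pos.le]
  linear_combination s / 4 * hpar

lemma exists_mem_argmin_sq_dist_add [CompleteSpace H] (hg : IsProper g) (hconv : IsConvex g)
    (hlsc : LowerSemicontinuous g) {s : ℝ} (hs : 0 < s) (u : H) :
    ∃ p, p ∈ argmin (objective (fun x => s * ‖x - u‖ ^ 2) g) := by
  obtain ⟨m, L, hL, hlower⟩ := exists_sub_mul_norm_le hg hconv hlsc
  refine exists_mem_argmin_of_midpoint_le (m := m - L * ‖u‖ - L ^ 2 / (4 * s))
    (div_pos hs four_pos) ?_ ?_ (fun x => ?_) fun x y b d hx hy => ?_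
  · have hcont : Continuous fun x : H => ((s * ‖x - u‖ ^ 2 : ℝ) : EReal) :=
      continuous_coe_real_ereal.comp (by fun_prop)
    exact hcont.lowerSemicontinuous.add' hlsc fun x =>
      EReal.continuousAt_add (.inl (EReal.coe_ne_top _)) (.inl (EReal.coe_ne_bot _))
  · obtain ⟨hbot, x, hx⟩ := hg
    lift g x to ℝ using ⟨hx, hbot x⟩ with c hc
    exact ⟨x, by rw [objective, ← hc, ← EReal.coe_add]; exact EReal.coe_ne_top _⟩
  · have hsq : 0 ≤ s * (‖x - u‖ - L / (2 * s)) ^ 2 := by positivity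
    have hexpand : s * (‖x - u‖ - L / (2 * s)) ^ 2
        = s * ‖x - u‖ ^ 2 - L * ‖x - u‖ + L ^ 2 / (4 * s) := by field_simp; ring
    have htri : L * ‖x‖ ≤ L * (‖x - u‖ + ‖u‖) := by
      gcongr
      simpa using norm_add_le (x - u) u
    calc _ ≤ ((s * ‖x - u‖ ^ 2 + (m - L * ‖x‖) : ℝ) : EReal) :=
          EReal.coe_le_coe_iff.2 (by linarith)
      _ ≤ _ := by
          rw [EReal.coe_add]
          exact add_le_add_right (hlower x) _
  · rw [objective_le_coe_iff] at hx hy ⊢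
    refine (hconv.le_of_le hx hy one_half_pos one_half_pos (by norm_num)).trans_eq ?_
    rw [sq_dist_midpoint]
    congr 1
    ring

lemma hasGradientAt_sq_dist [CompleteSpace H] (γ : ℝ) (u p : H) :
    HasGradientAt (fun x : H => 1 / (2 * γ) * ‖x - u‖ ^ 2) (γ⁻¹ • (p - u)) p := by
  rw [hasGradientAt_iff_hasFDerivAt]
  have h := (((hasFDerivAt_id p).sub_const u).norm_sq).const_mul (1 / (2 * γ))
  refine h.congr_fderiv ?_
  ext y
  simp only [one_div, mul_inv_rev, id_eq, map_sub, ContinuousLinearMap.comp_id, smul_apply,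
    sub_apply, coe_innerSL_apply, nsmul_eq_mul, Nat.cast_ofNat, smul_eq_mul, map_smul,
    InnerProductSpace.toDual_apply_apply]
  field_simp

lemma IsSubgradient.sq_norm_sub_le {p q u v : H} (hγ : 0 < γ)
    (hp : IsSubgradient g p (γ⁻¹ • (u - p))) (hq : IsSubgradient g q (γ⁻¹ • (v - q))) :
    ‖p - q‖ ^ 2 ≤ ⟪p - q, u - v⟫_ℝ := by
  have hmono := hp.monotone hq
  rw [← smul_sub, inner_smul_right, sub_sub_sub_comm, inner_sub_right,
    real_inner_self_eq_norm_sq] at hmono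
  exact sub_nonneg.1 (nonneg_of_mul_nonneg_right hmono (by positivity))

lemma isSubgradient_prox [CompleteSpace H] (hg : IsProper g) (hconv : IsConvex g)
    (hlsc : LowerSemicontinuous g) (hγ : 0 < γ) (u : H) :
    IsSubgradient g (prox γ g u) (γ⁻¹ • (u - prox γ g u)) := by
  have hmem : prox γ g u ∈ argmin (objective (fun x => 1 / (2 * γ) * ‖x - u‖ ^ 2) g) :=
    Classical.epsilon_spec (exists_mem_argmin_sq_dist_add hg hconv hlsc (by positivity) u)
  have h := isSubgradient_of_mem_argmin hg hconv (hasGradientAt_sq_dist γ u _) hmem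
  rwa [← smul_neg, neg_sub] at h

lemma isCocoercive_prox [CompleteSpace H] (hg : IsProper g) (hconv : IsConvex g)
    (hlsc : LowerSemicontinuous g) (hγ : 0 < γ) : IsCocoercive 1 (prox γ g) := fun u v => by
  rw [one_mul]
  exact (isSubgradient_prox hg hconv hlsc hγ u).sq_norm_sub_le hγ
    (isSubgradient_prox hg hconv hlsc hγ v)

lemma lipschitzWith_prox [CompleteSpace H] (hg : IsProper g) (hconv : IsConvex g)
    (hlsc : LowerSemicontinuous g) (hγ : 0 < γ) : LipschitzWith 1 (prox γ g) :=
  LipschitzWith.mk_one fun u v => by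
    simpa only [dist_eq_norm, one_mul] using
      (isCocoercive_prox hg hconv hlsc hγ).mul_norm_sub_le u v

lemma prox_eq_iff [CompleteSpace H] (hg : IsProper g) (hconv : IsConvex g)
    (hlsc : LowerSemicontinuous g) (hγ : 0 < γ) {u p : H} :
    prox γ g u = p ↔ IsSubgradient g p (γ⁻¹ • (u - p)) := by
  refine ⟨fun h => h ▸ isSubgradient_prox hg hconv hlsc hγ u, fun hp => ?_⟩
  have hsq := (isSubgradient_prox hg hconv hlsc hγ u).sq_norm_sub_le hγ hp
  rw [sub_self, inner_zero_right] at hsq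
  exact sub_eq_zero.1 (norm_eq_zero.1 (pow_eq_zero_iff two_ne_zero |>.1
    (le_antisymm hsq (sq_nonneg _))))

end Prox

section ForwardBackward

variable {H : Type*} [NormedAddCommGroup H] [InnerProductSpace ℝ H] [CompleteSpace H]
  {f : H → ℝ} {g : H → EReal} {β ρ : ℝ}

lemma fbOp_eq_self_iff (hf : ConvexOn ℝ Set.univ f) (hf' : Differentiable ℝ f) (hg : IsProper g)
    (hconv : IsConvex g) (hlsc : LowerSemicontinuous g) (hρ : 0 < ρ) {p : H} :
    fbOp ρ f g p = p ↔ p ∈ argmin (objective f g) := by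
  have harg : ρ⁻¹ • (p - ρ • ∇ f p - p) = -∇ f p := by
    rw [sub_sub_cancel_left, smul_neg, inv_smul_smul₀ hρ.ne']
  rw [fbOp, prox_eq_iff hg hconv hlsc hρ, harg]
  exact ⟨fun hp => hp.mem_argmin (add_inner_le_of_convexOn hf (hf' p).hasGradientAt),
    isSubgradient_of_mem_argmin hg hconv (hf' p).hasGradientAt⟩

lemma isCocoercive_sub_fbOp (hf : ConvexOn ℝ Set.univ f) (hf' : Differentiable ℝ f) (hβ : 0 < β)
    (hf_lip : ∀ x y, ‖∇ f x - ∇ f y‖ ≤ 1 / β * ‖x - y‖) (hg : IsProper g)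
    (hconv : IsConvex g) (hlsc : LowerSemicontinuous g) (hρ : 0 < ρ) :
    IsCocoercive ((4 * β - ρ) / (4 * β)) fun x => x - fbOp ρ f g x :=
  (isCocoercive_prox hg hconv hlsc hρ).forwardBackward
    (isCocoercive_gradient hf hf' hβ hf_lip) hβ hρ.le

lemma lipschitzWith_fbOp (hf : ConvexOn ℝ Set.univ f) (hf' : Differentiable ℝ f) (hβ : 0 < β)
    (hf_lip : ∀ x y, ‖∇ f x - ∇ f y‖ ≤ 1 / β * ‖x - y‖) (hg : IsProper g)
    (hconv : IsConvex g) (hlsc : LowerSemicontinuous g) (hρ : 0 < ρ) (hρβ : ρ ≤ 2 * β) :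
    LipschitzWith 1 (fbOp ρ f g) :=
  (isCocoercive_sub_fbOp hf hf' hβ hf_lip hg hconv hlsc hρ).lipschitzWith_one <| by
    rw [div_le_div_iff₀ two_pos (by positivity)]
    linarith

lemma isQuasiAveragedAt_fbOp (hf : ConvexOn ℝ Set.univ f) (hf' : Differentiable ℝ f) (hβ : 0 < β)
    (hf_lip : ∀ x y, ‖∇ f x - ∇ f y‖ ≤ 1 / β * ‖x - y‖) (hg : IsProper g)
    (hconv : IsConvex g) (hlsc : LowerSemicontinuous g) (hρ : 0 < ρ) {s : H}
    (hs : fbOp ρ f g s = s) : IsQuasiAveragedAt ((4 * β - ρ) / (2 * β)) (fbOp ρ f g) s := by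
  have hκ : 2 * ((4 * β - ρ) / (4 * β)) = (4 * β - ρ) / (2 * β) := by field_simp; norm_num
  exact hκ ▸ (isCocoercive_sub_fbOp hf hf' hβ hf_lip hg hconv hlsc hρ).isQuasiAveragedAt hs

end ForwardBackward

section WeakConvergence

variable {H : Type*} [NormedAddCommGroup H] [InnerProductSpace ℝ H] {ι : Type*} {l : Filter ι}
  {x y : ι → H} {p : H} {C : ℝ}

lemma tendsto_toWeakSpace_of_norm_sub
    (hx : Tendsto (fun k => toWeakSpace ℝ H (x k)) l (𝓝 (toWeakSpace ℝ H p)))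
    (hy : Tendsto (fun k => ‖y k - x k‖) l (𝓝 0)) :
    Tendsto (fun k => toWeakSpace ℝ H (y k)) l (𝓝 (toWeakSpace ℝ H p)) := by
  have hweak := ((toWeakSpaceCLM ℝ H).continuous.tendsto 0).comp
    (tendsto_zero_iff_norm_tendsto_zero.2 hy)
  simpa using hx.add hweak

variable [CompleteSpace H]

lemma tendsto_toWeakSpace_iff :
    Tendsto (fun k => toWeakSpace ℝ H (x k)) l (𝓝 (toWeakSpace ℝ H p)) ↔
      ∀ h, Tendsto (fun k => ⟪x k, h⟫_ℝ) l (𝓝 ⟪p, h⟫_ℝ) := by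
  have hinj : Function.Injective (topDualPairing ℝ H).flip := fun u v huv =>
    ext_inner_left ℝ fun w => by
      simpa using congrArg (fun L => L (InnerProductSpace.toDual ℝ H w)) huv
  refine (WeakBilin.tendsto_iff_forall_eval_tendsto _ hinj).trans
    ((InnerProductSpace.toDual ℝ H).surjective.forall.trans (forall_congr' fun h => ?_))
  simp only [real_inner_comm h]
  exact Iff.rfl

lemma exists_tendsto_toWeakSpace_of_norm_le (U : Ultrafilter ι) (hC : ∀ k, ‖x k‖ ≤ C) :
    ∃ p, Tendsto (fun k => toWeakSpace ℝ H (x k)) U (𝓝 (toWeakSpace ℝ H p)) := by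
  let D : ι → WeakDual ℝ H := fun k =>
    StrongDual.toWeakDual (InnerProductSpace.toDual ℝ H (x k))
  have hmem : ∀ k, D k ∈ WeakDual.toStrongDual ⁻¹' Metric.closedBall (0 : StrongDual ℝ H) C :=
    fun k => by simpa [D] using hC k
  obtain ⟨L, -, hL⟩ := (WeakDual.isCompact_closedBall 0 C).ultrafilter_le_nhds (U.map D)
    (tendsto_principal.2 (Eventually.of_forall hmem))
  refine ⟨(InnerProductSpace.toDual ℝ H).symm (WeakDual.toStrongDual L),
    tendsto_toWeakSpace_iff.2 fun h => ?_⟩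
  rw [InnerProductSpace.toDual_symm_apply]
  exact ((WeakDual.eval_continuous h).tendsto L).comp hL

/-- Opial's lemma. -/
lemma exists_tendsto_toWeakSpace_of_tendsto_norm_sub {x : ℕ → H} {S : Set H}
    (hC : ∀ k, ‖x k‖ ≤ C)
    (hdist : ∀ p ∈ S, ∃ l : ℝ, Tendsto (fun k => ‖x k - p‖) atTop (𝓝 l))
    (hcluster : ∀ U : Ultrafilter ℕ, ↑U ≤ (atTop : Filter ℕ) → ∀ p,
      Tendsto (fun k => toWeakSpace ℝ H (x k)) U (𝓝 (toWeakSpace ℝ H p)) → p ∈ S) :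
    ∃ p ∈ S, Tendsto (fun k => toWeakSpace ℝ H (x k)) atTop (𝓝 (toWeakSpace ℝ H p)) := by
  have hinner : ∀ p ∈ S, ∀ q ∈ S, ∃ m : ℝ, Tendsto (fun k => ⟪x k, p - q⟫_ℝ) atTop (𝓝 m) := by
    intro p hp q hq
    obtain ⟨l, hl⟩ := hdist p hp
    obtain ⟨m, hm⟩ := hdist q hq
    refine ⟨_, ((((hm.pow 2).sub (hl.pow 2)).add_const (‖p‖ ^ 2 - ‖q‖ ^ 2)).div_const 2).congr
      fun k => ?_⟩
    rw [norm_sub_sq_real, norm_sub_sq_real, inner_sub_right]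
    ring
  obtain ⟨p, hp⟩ := exists_tendsto_toWeakSpace_of_norm_le (Ultrafilter.of (atTop : Filter ℕ)) hC
  have hpS : p ∈ S := hcluster _ (Ultrafilter.of_le _) p hp
  refine ⟨p, hpS, tendsto_iff_ultrafilter _ _ _ |>.2 fun U hU => ?_⟩
  obtain ⟨q, hq⟩ := exists_tendsto_toWeakSpace_of_norm_le U hC
  obtain ⟨m, hm⟩ := hinner p hpS q (hcluster U hU q hq)
  have hpm : ⟪p, p - q⟫_ℝ = m := tendsto_nhds_unique (tendsto_toWeakSpace_iff.1 hp (p - q))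
    (hm.mono_left (Ultrafilter.of_le _))
  have hqm : ⟪q, p - q⟫_ℝ = m :=
    tendsto_nhds_unique (tendsto_toWeakSpace_iff.1 hq (p - q)) (hm.mono_left hU)
  have hpq : p = q := by
    rw [← sub_eq_zero, ← inner_self_eq_zero (𝕜 := ℝ), inner_sub_left, hpm, hqm, sub_self]
  exact hpq ▸ hq

/-- The demiclosedness principle: `I - T` is demiclosed at `0` for `T` nonexpansive. -/
lemma eq_of_tendsto_toWeakSpace [l.NeBot] {T : H → H} (hT : LipschitzWith 1 T)
    (hC : ∀ᶠ k in l, ‖x k‖ ≤ C)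
    (hx : Tendsto (fun k => toWeakSpace ℝ H (x k)) l (𝓝 (toWeakSpace ℝ H p)))
    (hTx : Tendsto (fun k => ‖T (x k) - x k‖) l (𝓝 0)) : T p = p := by
  have hineq (k : ι) (hk : ‖x k‖ ≤ C) : ‖p - T p‖ ^ 2 ≤
      ‖T (x k) - x k‖ * (‖T (x k) - x k‖ + 2 * (C + ‖p‖))
      - 2 * (⟪x k, p - T p⟫_ℝ - ⟪p, p - T p⟫_ℝ) := by
    have htri : ‖x k - T p‖ ≤ ‖T (x k) - x k‖ + ‖x k - p‖ := by
      rw [norm_sub_rev (T (x k))]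
      exact (norm_sub_le_norm_sub_add_norm_sub _ (T (x k)) _).trans
        (add_le_add_right (hT.norm_sub_le _ _ |>.trans_eq (one_mul _)) _)
    have hexpand : ‖x k - T p‖ ^ 2
        = ‖x k - p‖ ^ 2 + 2 * (⟪x k, p - T p⟫_ℝ - ⟪p, p - T p⟫_ℝ) + ‖p - T p‖ ^ 2 := by
      rw [← inner_sub_left, ← norm_add_sq_real, sub_add_sub_cancel]
    have hbound : ‖x k - p‖ ≤ C + ‖p‖ := (norm_sub_le _ _).trans (by gcongr)
    have hsq : ‖x k - T p‖ ^ 2 ≤ (‖T (x k) - x k‖ + ‖x k - p‖) ^ 2 := by gcongr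
    nlinarith [norm_nonneg (T (x k) - x k)]
  have hlim := (hTx.mul (hTx.add_const (2 * (C + ‖p‖)))).sub
    (((tendsto_toWeakSpace_iff.1 hx (p - T p)).sub_const ⟪p, p - T p⟫_ℝ).const_mul 2)
  have hle := ge_of_tendsto hlim (hC.mono hineq)
  rw [zero_mul, sub_self, mul_zero, sub_zero] at hle
  have hzero : ‖p - T p‖ = 0 := pow_eq_zero_iff two_ne_zero |>.1 (le_antisymm hle (sq_nonneg _))
  exact (sub_eq_zero.1 (norm_eq_zero.1 hzero)).symm

end WeakConvergence

section RealSequences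

variable {φ α ε c D r : ℕ → ℝ} {a σ : ℝ}

lemma summable_of_le_mul_add {p : ℕ → ℝ} (ha : a < 1) (hp : ∀ n, 0 ≤ p n) (hε : ∀ n, 0 ≤ ε n)
    (hsum : Summable ε) (hrec : ∀ n, p (n + 1) ≤ a * p n + ε n) : Summable p := by
  refine summable_of_sum_range_le (c := (p 0 + ∑' i, ε i) / (1 - a)) hp fun n => ?_
  rw [le_div_iff₀ (sub_pos.2 ha)]
  have hshift : ∑ i ∈ Finset.range n, p (i + 1)
      ≤ a * ∑ i ∈ Finset.range n, p i + ∑ i ∈ Finset.range n, ε i := by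
    rw [Finset.mul_sum, ← Finset.sum_add_distrib]
    exact Finset.sum_le_sum fun i _ => hrec i
  have hsplit : ∑ i ∈ Finset.range n, p i ≤ ∑ i ∈ Finset.range n, p (i + 1) + p 0 := by
    rw [← Finset.sum_range_succ', Finset.sum_range_succ]
    exact le_add_of_nonneg_right (hp n)
  linarith [hsum.sum_le_tsum (Finset.range n) fun i _ => hε i]

lemma exists_tendsto_of_summable_posPart (hφ : ∀ n, 0 ≤ φ n)
    (hsum : Summable fun n => max (φ (n + 1) - φ n) 0) : ∃ l, Tendsto φ atTop (𝓝 l) := by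
  set S : ℕ → ℝ := fun n => ∑ i ∈ Finset.range n, max (φ (i + 1) - φ i) 0 with hS
  have hanti : Antitone fun n => φ n - S n := antitone_nat_of_succ_le fun n => by
    simp only [hS, Finset.sum_range_succ]
    linarith [le_max_left (φ (n + 1) - φ n) 0]
  have hbdd : BddBelow (Set.range fun n => φ n - S n) := by
    refine ⟨-∑' n, max (φ (n + 1) - φ n) 0, ?_⟩
    rintro _ ⟨n, rfl⟩
    have hle : S n ≤ _ := hsum.sum_le_tsum (Finset.range n) fun i _ => le_max_right _ _
    linarith [hφ n]
  exact ⟨_, ((tendsto_atTop_ciInf hanti hbdd).add hsum.hasSum.tendsto_sum_nat).congr fun n => by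
    simp [hS]⟩

lemma tendsto_zero_of_summable_sq {r : ℕ → ℝ} (hr : ∀ n, 0 ≤ r n)
    (hsum : Summable fun n => r n ^ 2) : Tendsto r atTop (𝓝 0) := by
  simpa [Real.sqrt_sq (hr _)] using hsum.tendsto_atTop_zero.sqrt

lemma mul_le_mul_posPart {s t : ℝ} (hs : 0 ≤ s) (hsa : s ≤ a) : s * t ≤ a * max t 0 :=
  (mul_le_mul_of_nonneg_left (le_max_left _ _) hs).trans
    (mul_le_mul_of_nonneg_right hsa (le_max_right _ _))

lemma summable_posPart_of_inertial (hα : ∀ n, 0 ≤ α n ∧ α n ≤ a) (ha : a < 1)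
    (hε : ∀ n, 0 ≤ ε n) (hsum : Summable ε)
    (hrec : ∀ n, φ (n + 2) - φ (n + 1) ≤ α n * (φ (n + 1) - φ n) + ε n) :
    Summable fun n => max (φ (n + 1) - φ n) 0 := by
  refine summable_of_le_mul_add ha (fun n => le_max_right _ _) hε hsum fun n => max_le ?_ ?_
  · linarith [hrec n, mul_le_mul_posPart (t := φ (n + 1) - φ n) (hα n).1 (hα n).2]
  · have ha₀ : 0 ≤ a := (hα n).1.trans (hα n).2
    exact add_nonneg (mul_nonneg ha₀ (le_max_right _ _)) (hε n)

lemma sum_decrease_le_of_inertial (hα : ∀ n, 0 ≤ α n ∧ α n ≤ a) (hφ : ∀ n, 0 ≤ φ n)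
    (hε : ∀ n, 0 ≤ ε n) (hp : Summable fun n => max (φ (n + 1) - φ n) 0) (hsum : Summable ε)
    (hrec : ∀ n, φ (n + 2) - φ (n + 1) ≤ α n * (φ (n + 1) - φ n) + ε n - c n) (k : ℕ) :
    ∑ n ∈ Finset.range k, c n ≤ φ 1 + (a * ∑' n, max (φ (n + 1) - φ n) 0 + ∑' n, ε n) := by
  have ha : 0 ≤ a := (hα 0).1.trans (hα 0).2
  have hterm (n : ℕ) :
      c n ≤ (φ (n + 1) - φ (n + 1 + 1)) + (a * max (φ (n + 1) - φ n) 0 + ε n) := by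
    linarith [hrec n, mul_le_mul_posPart (t := φ (n + 1) - φ n) (hα n).1 (hα n).2]
  calc ∑ n ∈ Finset.range k, c n
      ≤ ∑ n ∈ Finset.range k,
          ((φ (n + 1) - φ (n + 1 + 1)) + (a * max (φ (n + 1) - φ n) 0 + ε n)) :=
        Finset.sum_le_sum fun n _ => hterm n
    _ = (φ 1 - φ (k + 1)) + (a * ∑ n ∈ Finset.range k, max (φ (n + 1) - φ n) 0
          + ∑ n ∈ Finset.range k, ε n) := by
        rw [Finset.sum_add_distrib, Finset.sum_add_distrib, Finset.mul_sum,
          Finset.sum_range_sub' fun n => φ (n + 1)]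
    _ ≤ φ 1 + (a * ∑' n, max (φ (n + 1) - φ n) 0 + ∑' n, ε n) := by
        gcongr
        · linarith [hφ (k + 1)]
        · exact hp.sum_le_tsum _ fun n _ => le_max_right _ _
        · exact hsum.sum_le_tsum _ fun n _ => hε n

lemma summable_of_lyapunov {G C : ℝ} (hα : ∀ n, 0 ≤ α n ∧ α n ≤ a) (hmono : Monotone α)
    (hG : 0 ≤ G) (hσ : 0 < σ) (hφ : ∀ n, 0 ≤ φ n) (hφC : ∀ n, φ n ≤ C) (hD : ∀ n, 0 ≤ D n)
    (hε : ∀ n, 0 ≤ ε n) (hsum : Summable ε)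
    (hrec : ∀ n, φ (n + 2) - φ (n + 1) ≤
      α n * (φ (n + 1) - φ n) + (G * D n - (G + σ) * D (n + 1)) + ε n) :
    Summable D := by
  set Ψ : ℕ → ℝ := fun n => φ (n + 1) - α n * φ n + G * D n with hΨ
  have hstep (n : ℕ) : σ * D (n + 1) ≤ (Ψ n - Ψ (n + 1)) + ε n := by
    have hα_succ : α n * φ (n + 1) ≤ α (n + 1) * φ (n + 1) :=
      mul_le_mul_of_nonneg_right (hmono n.le_succ) (hφ (n + 1))
    simp only [hΨ]
    linarith [hrec n]
  have hlower (n : ℕ) : -(a * C) ≤ Ψ n := by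
    have hαφ : α n * φ n ≤ a * C :=
      mul_le_mul (hα n).2 (hφC n) (hφ n) ((hα n).1.trans (hα n).2)
    simp only [hΨ]
    linarith [hφ (n + 1), mul_nonneg hG (hD n)]
  rw [← summable_nat_add_iff 1]
  refine summable_of_sum_range_le (c := (Ψ 0 + a * C + ∑' i, ε i) / σ) (fun n => hD _) fun n => ?_
  rw [le_div_iff₀' hσ, Finset.mul_sum]
  have htelescope := Finset.sum_le_sum fun i (_ : i ∈ Finset.range n) => hstep i
  rw [Finset.sum_add_distrib, Finset.sum_range_sub'] at htelescope
  linarith [hlower n, hsum.sum_le_tsum (Finset.range n) fun i _ => hε i]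

lemma inf'_Icc_le_of_sum_le {K B : ℝ} (hK : 0 < K) {k : ℕ} (hk : 1 ≤ k)
    (hsum : ∑ i ∈ Finset.range k, K * r (i + 1) ≤ B) :
    (Finset.Icc 1 k).inf' (Finset.nonempty_Icc.2 hk) r ≤ 1 / (k * K) * B := by
  have hkK : 0 < k * K := mul_pos (Nat.cast_pos.2 hk) hK
  rw [one_div_mul_eq_div, le_div_iff₀ hkK]
  refine le_trans ?_ hsum
  have hmin : ∀ i ∈ Finset.range k,
      K * (Finset.Icc 1 k).inf' (Finset.nonempty_Icc.2 hk) r ≤ K * r (i + 1) := fun i hi =>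
    mul_le_mul_of_nonneg_left (Finset.inf'_le r (Finset.mem_Icc.2
      ⟨i.succ_pos, Finset.mem_range.1 hi⟩)) hK.le
  have hcard := Finset.card_nsmul_le_sum _ _ _ hmin
  rw [Finset.card_range, nsmul_eq_mul] at hcard
  linarith

end RealSequences

section RelaxationBound

variable {a s δ σ l Q : ℝ}

/-- The upper bound of the relaxation parameters in the second set of conditions, relative to the
bound `κ` for the scheme without inertia: `lamBar` is `κ` times this ratio. -/
noncomputable def relaxRatio (a σ δ : ℝ) : ℝ :=
  (δ - a * (a * (1 + a) + a * δ + σ)) / (δ * (1 + a * (1 + a) + a * δ + σ))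

lemma relaxRatio_lt_one (ha : 0 ≤ a) (hσ : 0 < σ) (hδ : 0 < δ) : relaxRatio a σ δ < 1 := by
  rw [relaxRatio, div_lt_one (by positivity)]
  have hnum : 0 ≤ a * (a * (1 + a) + a * δ + σ) := by positivity
  have hden : 0 < δ * (a * (1 + a) + a * δ + σ) := by positivity
  linarith

lemma mul_weighted_sub_le (hs : 0 ≤ s) (hδ : 0 < δ) (hl : 0 < l) (A B : ℝ) :
    l * (δ / (s + δ * l) * A ^ 2 - s * δ * B ^ 2)
      ≤ A ^ 2 - 2 * s * (A * B) + s ^ 2 * B ^ 2 := by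
  have hsquare : A ^ 2 - 2 * s * (A * B) + s ^ 2 * B ^ 2
      - l * (δ / (s + δ * l) * A ^ 2 - s * δ * B ^ 2)
      = s / (s + δ * l) * (A - (s + δ * l) * B) ^ 2 := by
    field_simp
    ring
  have hnonneg : 0 ≤ s / (s + δ * l) * (A - (s + δ * l) * B) ^ 2 := by positivity
  linarith

lemma add_mul_mul_le_of_le_div (hsa : s ≤ a) (hδ : 0 < δ) (hQ : 0 < Q)
    (hl : l ≤ (δ - a * Q) / (δ * (1 + Q))) : (s + δ * l) * Q ≤ δ * (1 - l) := by
  rw [le_div_iff₀ (by positivity)] at hl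
  linarith [mul_le_mul_of_nonneg_right hsa hQ.le]

lemma relaxation_quadratic_bound (hs : 0 ≤ s) (hsa : s ≤ a) (hδ : 0 < δ) (hσ : 0 < σ)
    (hl : 0 < l) (hle : l ≤ relaxRatio a σ δ) (A B : ℝ) :
    (a * (1 + a) + a * δ + σ) * A ^ 2 - (a * (1 + a) + a * δ - s * (1 + s)) * B ^ 2 ≤
      (1 - l) / l * (A ^ 2 - 2 * s * (A * B) + s ^ 2 * B ^ 2) := by
  have ha : 0 ≤ a := hs.trans hsa
  have hm : 0 < s + δ * l := by positivity
  have hQ : 0 < a * (1 + a) + a * δ + σ := by positivity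
  have hweight : (s + δ * l) * (a * (1 + a) + a * δ + σ) ≤ δ * (1 - l) :=
    add_mul_mul_le_of_le_div hsa hδ hQ (by convert hle using 1; rw [relaxRatio]; ring)
  have hl_le : 0 ≤ 1 - l :=
    nonneg_of_mul_nonneg_right ((mul_pos hm hQ).le.trans hweight) hδ
  have hA : a * (1 + a) + a * δ + σ ≤ (1 - l) * (δ / (s + δ * l)) := by
    rw [← mul_div_assoc, le_div_iff₀ hm]
    linarith
  have hB : s * (1 + s) + (1 - l) * (s * δ) ≤ a * (1 + a) + a * δ := by
    have hl_one : (1 - l) * (s * δ) ≤ s * δ :=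
      mul_le_of_le_one_left (by positivity) (by linarith)
    have hsδ : s * (1 + s) + s * δ ≤ a * (1 + a) + a * δ := by gcongr
    linarith
  calc _ ≤ (1 - l) * (δ / (s + δ * l)) * A ^ 2 - (1 - l) * (s * δ) * B ^ 2 := by
        linarith [mul_le_mul_of_nonneg_right hA (sq_nonneg A),
          mul_le_mul_of_nonneg_right hB (sq_nonneg B)]
    _ = (1 - l) / l * (l * (δ / (s + δ * l) * A ^ 2 - s * δ * B ^ 2)) := by field_simp
    _ ≤ _ := mul_le_mul_of_nonneg_left (mul_weighted_sub_le hs hδ hl A B) (div_nonneg hl_le hl.le)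

end RelaxationBound

section QuasiAveraged

variable {H : Type*} [NormedAddCommGroup H] [InnerProductSpace ℝ H] {T : H → H} {s : H} {κ l : ℝ}

lemma norm_inertial_sub_sq (p q s : H) (t : ℝ) :
    ‖p + t • (p - q) - s‖ ^ 2
      = (1 + t) * ‖p - s‖ ^ 2 - t * ‖q - s‖ ^ 2 + t * (1 + t) * ‖p - q‖ ^ 2 := by
  have hleft : p + t • (p - q) - s = (p - s) + t • ((p - s) - (q - s)) := by module
  rw [hleft, ← sub_sub_sub_cancel_right p q s]
  generalize p - s = u
  generalize q - s = v
  rw [norm_add_sq_real, norm_smul, inner_smul_right, mul_pow, Real.norm_eq_abs, sq_abs,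
    norm_sub_sq_real, inner_sub_right, real_inner_self_eq_norm_sq]
  ring

lemma norm_sub_smul_sq_ge (v w : H) {t : ℝ} (ht : 0 ≤ t) :
    ‖v‖ ^ 2 - 2 * t * (‖v‖ * ‖w‖) + t ^ 2 * ‖w‖ ^ 2 ≤ ‖v - t • w‖ ^ 2 := by
  rw [norm_sub_sq_real, inner_smul_right, norm_smul, mul_pow, Real.norm_eq_abs, sq_abs]
  linarith [mul_le_mul_of_nonneg_left (real_inner_le_norm v w) ht]

lemma IsQuasiAveragedAt.sq_norm_relaxed_sub_le (hT : IsQuasiAveragedAt κ T s) (hl : 0 ≤ l)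
    (y e : H) :
    ‖y + l • (T y + e - y) - s‖ ^ 2 ≤ ‖y - s‖ ^ 2
      + 2 * ‖y + l • (T y + e - y) - s‖ * l * ‖e‖ - l * (κ - l) * ‖T y - y‖ ^ 2 := by
  set w := y + l • (T y + e - y) - s with hw
  have hexact : ‖w - l • e‖ ^ 2
      = ‖y - s‖ ^ 2 - 2 * l * ⟪y - T y, y - s⟫_ℝ + l ^ 2 * ‖T y - y‖ ^ 2 := by
    have hwe : w - l • e = (y - s) - l • (y - T y) := by rw [hw]; module
    rw [hwe, norm_sub_sq_real, norm_smul, mul_pow, Real.norm_eq_abs, sq_abs, inner_smul_right,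
      norm_sub_rev y (T y), real_inner_comm]
    ring
  have hle : 0 ≤ l ^ 2 * ‖e‖ ^ 2 := by positivity
  linarith [norm_sub_smul_sq_ge w e hl, mul_le_mul_of_nonneg_left (hT y) hl]

lemma sq_norm_smul_add_le (hl : 0 < l) (hlκ : l ≤ κ) (r e : H) :
    (κ - l) / l * ‖l • (r + e)‖ ^ 2 - 2 * (κ - l) * ‖l • (r + e)‖ * ‖e‖
      ≤ l * (κ - l) * ‖r‖ ^ 2 := by
  have hsq : ‖l • (r + e)‖ ^ 2 - 2 * l * (‖l • (r + e)‖ * ‖e‖) ≤ l ^ 2 * ‖r‖ ^ 2 := by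
    have hr : l • r = l • (r + e) - l • e := by rw [smul_add, add_sub_cancel_right]
    have hlr : l ^ 2 * ‖r‖ ^ 2 = ‖l • (r + e) - l • e‖ ^ 2 := by
      rw [← hr, norm_smul, mul_pow, Real.norm_eq_abs, sq_abs]
    have hle : 0 ≤ l ^ 2 * ‖e‖ ^ 2 := by positivity
    linarith [norm_sub_smul_sq_ge (l • (r + e)) e hl.le]
  calc _ = (κ - l) / l * (‖l • (r + e)‖ ^ 2 - 2 * l * (‖l • (r + e)‖ * ‖e‖)) := by field_simp
    _ ≤ (κ - l) / l * (l ^ 2 * ‖r‖ ^ 2) :=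
      mul_le_mul_of_nonneg_left hsq (div_nonneg (sub_nonneg.2 hlκ) hl.le)
    _ = _ := by field_simp

end QuasiAveraged

section KMCondition

variable {H : Type*} [NormedAddCommGroup H] {α lam : ℕ → ℝ} {e x : ℕ → H} {κ a lamLow lamUp : ℝ}

/-- Conditions under which the inexact inertial Krasnoselskii–Mann iteration of an operator that
is averaged with constant `1 / κ` converges weakly. -/
structure KMCondition (κ : ℝ) (α lam : ℕ → ℝ) (e x : ℕ → H) (a lamLow lamUp : ℝ) : Prop where
  inertia_bounds : ∀ n, 0 ≤ α n ∧ α n ≤ a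
  a_lt_one : a < 1
  lamLow_pos : 0 < lamLow
  relax_bounds : ∀ n, lamLow ≤ lam n ∧ lam n ≤ lamUp
  lamUp_lt : lamUp < κ
  summable_inertia : Summable fun n => α n * ‖x (n + 1) - x n‖ ^ 2
  summable_error : Summable fun n => lam n * ‖e n‖
  bounded : Bornology.IsBounded (Set.range x)

/-- The perturbation, due to the errors and to the inertia, of the monotonicity of `‖x n - s‖ ^ 2`
along the iteration. -/
def perturbation (α lam : ℕ → ℝ) (e x : ℕ → H) (s : H) (n : ℕ) : ℝ :=
  2 * ‖x (n + 2) - s‖ * lam n * ‖e n‖ + α n * (1 + α n) * ‖x (n + 1) - x n‖ ^ 2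

lemma KMCondition.relax_pos (hc : KMCondition κ α lam e x a lamLow lamUp) (n : ℕ) : 0 < lam n :=
  hc.lamLow_pos.trans_le (hc.relax_bounds n).1

lemma KMCondition.inertia_le_one (hc : KMCondition κ α lam e x a lamLow lamUp) (n : ℕ) :
    α n ≤ 1 :=
  (hc.inertia_bounds n).2.trans hc.a_lt_one.le

lemma KMCondition.mul_gap_pos (hc : KMCondition κ α lam e x a lamLow lamUp) :
    0 < lamLow * (κ - lamUp) :=
  mul_pos hc.lamLow_pos (sub_pos.2 hc.lamUp_lt)

lemma KMCondition.summable_inertiaTerm (hc : KMCondition κ α lam e x a lamLow lamUp) :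
    Summable fun n => α n * (1 + α n) * ‖x (n + 1) - x n‖ ^ 2 := by
  refine Summable.of_nonneg_of_le (fun n => ?_) (fun n => ?_) (hc.summable_inertia.mul_left 2)
  · have hα := (hc.inertia_bounds n).1
    positivity
  · have hα : 1 + α n ≤ 2 := by linarith [hc.inertia_le_one n]
    calc α n * (1 + α n) * ‖x (n + 1) - x n‖ ^ 2
        = (1 + α n) * (α n * ‖x (n + 1) - x n‖ ^ 2) := by ring
      _ ≤ 2 * (α n * ‖x (n + 1) - x n‖ ^ 2) :=
        mul_le_mul_of_nonneg_right hα (mul_nonneg (hc.inertia_bounds n).1 (sq_nonneg _))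

lemma KMCondition.summable_errTerm (hc : KMCondition κ α lam e x a lamLow lamUp) (s : H) :
    Summable fun n => 2 * ‖x (n + 2) - s‖ * lam n * ‖e n‖ := by
  obtain ⟨C, hC⟩ := hc.bounded.exists_norm_le
  rw [Set.forall_mem_range] at hC
  refine Summable.of_nonneg_of_le (fun n => ?_) (fun n => ?_)
    (hc.summable_error.mul_left (2 * (C + ‖s‖)))
  · have hlam := (hc.relax_pos n).le
    positivity
  · rw [mul_assoc]
    have hxs : ‖x (n + 2) - s‖ ≤ C + ‖s‖ := norm_sub_le_of_le (hC _) le_rfl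
    have herr := mul_nonneg (hc.relax_pos n).le (norm_nonneg (e n))
    gcongr

lemma KMCondition.summable_perturbation (hc : KMCondition κ α lam e x a lamLow lamUp) (s : H) :
    Summable (perturbation α lam e x s) :=
  (hc.summable_errTerm s).add hc.summable_inertiaTerm

lemma KMCondition.perturbation_nonneg (hc : KMCondition κ α lam e x a lamLow lamUp) (s : H)
    (n : ℕ) : 0 ≤ perturbation α lam e x s n := by
  have hα := (hc.inertia_bounds n).1
  have hlam := (hc.relax_pos n).le
  rw [perturbation]
  positivity

end KMCondition

section InertialKM

variable {H : Type*} [NormedAddCommGroup H] [InnerProductSpace ℝ H] {T : H → H} {s : H}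
  {α lam : ℕ → ℝ} {e x y : ℕ → H} {κ a lamLow lamUp σ δ C : ℝ}

/-- The inexact inertial Krasnoselskii–Mann iteration of `T` from the starting points `x 0` and
`x 1`; the extrapolation `y n` and the error `e n` belong to the step from `x (n + 1)` to
`x (n + 2)`. -/
structure IsInertialKM (T : H → H) (α lam : ℕ → ℝ) (e x y : ℕ → H) : Prop where
  inertial : ∀ n, y n = x (n + 1) + α n • (x (n + 1) - x n)
  step : ∀ n, x (n + 2) = y n + lam n • (T (y n) + e n - y n)

lemma IsInertialKM.sq_norm_sub_sub_le (hx : IsInertialKM T α lam e x y)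
    (hT : IsQuasiAveragedAt κ T s) {n : ℕ} (hlam : 0 ≤ lam n) :
    ‖x (n + 2) - s‖ ^ 2 - ‖x (n + 1) - s‖ ^ 2 ≤
      α n * (‖x (n + 1) - s‖ ^ 2 - ‖x n - s‖ ^ 2) + perturbation α lam e x s n
        - lam n * (κ - lam n) * ‖T (y n) - y n‖ ^ 2 := by
  have hstep := hT.sq_norm_relaxed_sub_le hlam (y n) (e n)
  have hinertial := norm_inertial_sub_sq (x (n + 1)) (x n) s (α n)
  rw [← hx.inertial n] at hinertial
  rw [← hx.step n, hinertial] at hstep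
  rw [perturbation]
  linarith

lemma IsInertialKM.norm_sub_le (hx : IsInertialKM T α lam e x y) (hα : ∀ n, 0 ≤ α n ∧ α n ≤ 1)
    (hC : ∀ n, ‖x n‖ ≤ C) (n : ℕ) : ‖y n - x (n + 1)‖ ≤ 2 * C := by
  rw [hx.inertial n, add_sub_cancel_left, norm_smul, Real.norm_of_nonneg (hα n).1, two_mul]
  exact (mul_le_of_le_one_left (norm_nonneg _) (hα n).2).trans
    ((_root_.norm_sub_le _ _).trans (add_le_add (hC _) (hC n)))

lemma IsInertialKM.sq_norm_sub_sub_le_of_le_relaxRatio (hx : IsInertialKM T α lam e x y)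
    (hT : IsQuasiAveragedAt κ T s) {n : ℕ} (hα : 0 ≤ α n ∧ α n ≤ a) (hσ : 0 < σ) (hδ : 0 < δ)
    (hκ : 0 < κ) (hlam : 0 < lam n) (hle : lam n ≤ κ * relaxRatio a σ δ) :
    ‖x (n + 2) - s‖ ^ 2 - ‖x (n + 1) - s‖ ^ 2 ≤
      α n * (‖x (n + 1) - s‖ ^ 2 - ‖x n - s‖ ^ 2)
        + ((a * (1 + a) + a * δ) * ‖x (n + 1) - x n‖ ^ 2
          - (a * (1 + a) + a * δ + σ) * ‖x (n + 2) - x (n + 1)‖ ^ 2)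
        + 2 * (‖x (n + 2) - s‖ * lam n + (κ - lam n) * ‖x (n + 2) - y n‖) * ‖e n‖ := by
  have hratio : lam n / κ ≤ relaxRatio a σ δ := (div_le_iff₀' hκ).2 hle
  have hlamκ : lam n ≤ κ :=
    (div_le_one hκ).1 (hratio.trans (relaxRatio_lt_one (hα.1.trans hα.2) hσ hδ).le)
  have hstep : x (n + 2) - y n = lam n • (T (y n) - y n + e n) := by rw [hx.step n]; module
  have hresidual := sq_norm_smul_add_le hlam hlamκ (T (y n) - y n) (e n)
  have hincrement : ‖x (n + 2) - x (n + 1)‖ ^ 2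
      - 2 * α n * (‖x (n + 2) - x (n + 1)‖ * ‖x (n + 1) - x n‖)
      + α n ^ 2 * ‖x (n + 1) - x n‖ ^ 2 ≤ ‖x (n + 2) - y n‖ ^ 2 := by
    rw [hx.inertial n, ← sub_sub]
    exact norm_sub_smul_sq_ge _ _ hα.1
  have hscaled := mul_le_mul_of_nonneg_left hincrement
    (div_nonneg (sub_nonneg.2 hlamκ) hlam.le)
  have hquad := relaxation_quadratic_bound hα.1 hα.2 hδ hσ (div_pos hlam hκ) hratio
    ‖x (n + 2) - x (n + 1)‖ ‖x (n + 1) - x n‖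
  have hnormalize : (1 - lam n / κ) / (lam n / κ) = (κ - lam n) / lam n := by field_simp
  rw [← hstep] at hresidual
  rw [hnormalize] at hquad
  have hbasic := hx.sq_norm_sub_sub_le hT hlam.le
  rw [perturbation] at hbasic
  linarith

lemma IsInertialKM.summable_sq_norm_sub (hx : IsInertialKM T α lam e x y)
    (hT : IsQuasiAveragedAt κ T s) (hα : ∀ n, 0 ≤ α n ∧ α n ≤ a) (ha : a ≤ 1)
    (hmono : Monotone α) (hσ : 0 < σ) (hδ : 0 < δ) (hκ : 0 < κ) (hlam : ∀ n, 0 < lam n)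
    (hle : ∀ n, lam n ≤ κ * relaxRatio a σ δ) (he : Summable fun n => ‖e n‖)
    (hbdd : Bornology.IsBounded (Set.range x)) :
    Summable fun n => ‖x (n + 1) - x n‖ ^ 2 := by
  obtain ⟨C, hC⟩ := hbdd.exists_norm_le
  rw [Set.forall_mem_range] at hC
  have ha₀ : 0 ≤ a := (hα 0).1.trans (hα 0).2
  have hC₀ : 0 ≤ C := (norm_nonneg _).trans (hC 0)
  have hxs (n : ℕ) : ‖x n - s‖ ≤ C + ‖s‖ := (_root_.norm_sub_le _ _).trans (by gcongr; exact hC n)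
  have hxy (n : ℕ) : ‖x (n + 2) - y n‖ ≤ 4 * C := by
    have hyx := hx.norm_sub_le (fun n => ⟨(hα n).1, (hα n).2.trans ha⟩) hC n
    rw [norm_sub_rev] at hyx
    have hxx : ‖x (n + 2) - x (n + 1)‖ ≤ C + C := norm_sub_le_of_le (hC _) (hC _)
    linarith [norm_sub_le_norm_sub_add_norm_sub (x (n + 2)) (x (n + 1)) (y n)]
  refine summable_of_lyapunov hα hmono (G := a * (1 + a) + a * δ) (by positivity) hσ
    (φ := fun n => ‖x n - s‖ ^ 2) (C := (C + ‖s‖) ^ 2) (fun n => sq_nonneg _)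
    (fun n => pow_le_pow_left₀ (norm_nonneg _) (hxs n) 2) (fun n => sq_nonneg _)
    (ε := fun n => 2 * ((C + ‖s‖) * κ + κ * (4 * C)) * ‖e n‖) (fun n => by positivity)
    (he.mul_left _) fun n => ?_
  have hlamκ : lam n ≤ κ :=
    (hle n).trans (mul_le_of_le_one_right hκ.le (relaxRatio_lt_one ha₀ hσ hδ).le)
  refine (hx.sq_norm_sub_sub_le_of_le_relaxRatio hT (hα n) hσ hδ hκ (hlam n) (hle n)).trans ?_
  gcongr
  · exact (hlam n).le
  · exact hxs _
  · linarith [hlam n]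
  · exact hxy n

lemma IsInertialKM.sq_norm_sub_sub_le_of_kmCondition (hx : IsInertialKM T α lam e x y)
    (hc : KMCondition κ α lam e x a lamLow lamUp) (hT : IsQuasiAveragedAt κ T s) (n : ℕ) :
    ‖x (n + 2) - s‖ ^ 2 - ‖x (n + 1) - s‖ ^ 2 ≤
      α n * (‖x (n + 1) - s‖ ^ 2 - ‖x n - s‖ ^ 2) + perturbation α lam e x s n
        - lamLow * (κ - lamUp) * ‖T (y n) - y n‖ ^ 2 := by
  have hrelax : lamLow * (κ - lamUp) ≤ lam n * (κ - lam n) :=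
    mul_le_mul (hc.relax_bounds n).1 (sub_le_sub_left (hc.relax_bounds n).2 κ)
      (sub_pos.2 hc.lamUp_lt).le (hc.relax_pos n).le
  linarith [hx.sq_norm_sub_sub_le hT (hc.relax_pos n).le,
    mul_le_mul_of_nonneg_right hrelax (sq_nonneg ‖T (y n) - y n‖)]

lemma IsInertialKM.summable_posPart (hx : IsInertialKM T α lam e x y)
    (hc : KMCondition κ α lam e x a lamLow lamUp) (hT : IsQuasiAveragedAt κ T s) :
    Summable fun n => max (‖x (n + 1) - s‖ ^ 2 - ‖x n - s‖ ^ 2) 0 :=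
  summable_posPart_of_inertial (φ := fun n => ‖x n - s‖ ^ 2) hc.inertia_bounds hc.a_lt_one
    (hc.perturbation_nonneg s) (hc.summable_perturbation s) fun n =>
      (hx.sq_norm_sub_sub_le_of_kmCondition hc hT n).trans
        (sub_le_self _ (mul_nonneg hc.mul_gap_pos.le (sq_nonneg _)))

lemma IsInertialKM.exists_tendsto_norm_sub (hx : IsInertialKM T α lam e x y)
    (hc : KMCondition κ α lam e x a lamLow lamUp) (hT : IsQuasiAveragedAt κ T s) :
    ∃ l, Tendsto (fun n => ‖x n - s‖) atTop (𝓝 l) := by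
  obtain ⟨l, hl⟩ := exists_tendsto_of_summable_posPart (fun n => sq_nonneg ‖x n - s‖)
    (hx.summable_posPart hc hT)
  exact ⟨√l, hl.sqrt.congr fun n => Real.sqrt_sq (norm_nonneg _)⟩

lemma IsInertialKM.sum_residual_le (hx : IsInertialKM T α lam e x y)
    (hc : KMCondition κ α lam e x a lamLow lamUp) (hT : IsQuasiAveragedAt κ T s) (k : ℕ) :
    ∑ n ∈ Finset.range k, lamLow * (κ - lamUp) * ‖T (y n) - y n‖ ^ 2 ≤
      ‖x 1 - s‖ ^ 2 + (a * ∑' n, max (‖x (n + 1) - s‖ ^ 2 - ‖x n - s‖ ^ 2) 0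
        + ∑' n, perturbation α lam e x s n) :=
  sum_decrease_le_of_inertial hc.inertia_bounds (fun n => sq_nonneg ‖x n - s‖)
    (hc.perturbation_nonneg s) (hx.summable_posPart hc hT) (hc.summable_perturbation s)
    (hx.sq_norm_sub_sub_le_of_kmCondition hc hT) k

lemma IsInertialKM.tendsto_residual (hx : IsInertialKM T α lam e x y)
    (hc : KMCondition κ α lam e x a lamLow lamUp) (hT : IsQuasiAveragedAt κ T s) :
    Tendsto (fun n => ‖T (y n) - y n‖) atTop (𝓝 0) := by
  have hsum := summable_of_sum_range_le
    (fun n => mul_nonneg hc.mul_gap_pos.le (sq_nonneg ‖T (y n) - y n‖)) (hx.sum_residual_le hc hT)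
  rw [summable_mul_left_iff hc.mul_gap_pos.ne'] at hsum
  exact tendsto_zero_of_summable_sq (fun n => norm_nonneg _) hsum

lemma IsInertialKM.tendsto_norm_sub (hx : IsInertialKM T α lam e x y)
    (hc : KMCondition κ α lam e x a lamLow lamUp) :
    Tendsto (fun n => ‖y n - x (n + 1)‖) atTop (𝓝 0) := by
  refine tendsto_zero_of_summable_sq (fun n => norm_nonneg _)
    (hc.summable_inertia.of_nonneg_of_le (fun n => sq_nonneg _) fun n => ?_)
  have hα := (hc.inertia_bounds n).1
  rw [hx.inertial n, add_sub_cancel_left, norm_smul, Real.norm_of_nonneg hα, mul_pow]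
  exact mul_le_mul_of_nonneg_right (pow_le_of_le_one hα (hc.inertia_le_one n) two_ne_zero)
    (sq_nonneg _)

lemma IsInertialKM.exists_tendsto_toWeakSpace [CompleteSpace H] (hx : IsInertialKM T α lam e x y)
    (hc : KMCondition κ α lam e x a lamLow lamUp) (hT : LipschitzWith 1 T)
    (hquasi : ∀ s, T s = s → IsQuasiAveragedAt κ T s) (hfix : ∃ s, T s = s) :
    ∃ p, T p = p ∧ Tendsto (fun n => toWeakSpace ℝ H (x n)) atTop (𝓝 (toWeakSpace ℝ H p)) := by
  obtain ⟨s, hs⟩ := hfix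
  obtain ⟨C, hC⟩ := hc.bounded.exists_norm_le
  rw [Set.forall_mem_range] at hC
  have hy (n : ℕ) : ‖y n‖ ≤ 2 * C + C := by
    have hyx := hx.norm_sub_le (fun n => ⟨(hc.inertia_bounds n).1, hc.inertia_le_one n⟩) hC n
    linarith [norm_le_norm_sub_add (y n) (x (n + 1)), hC (n + 1)]
  obtain ⟨p, hp, hlim⟩ := exists_tendsto_toWeakSpace_of_tendsto_norm_sub
    (x := fun n => x (n + 1)) (S := {p | T p = p}) (fun n => hC (n + 1))
    (fun p hp => (hx.exists_tendsto_norm_sub hc (hquasi p hp)).imp fun l hl =>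
      hl.comp (tendsto_add_atTop_nat 1)) fun U hU p hp =>
    eq_of_tendsto_toWeakSpace hT (.of_forall hy)
      (tendsto_toWeakSpace_of_norm_sub hp ((hx.tendsto_norm_sub hc).mono_left hU))
      ((hx.tendsto_residual hc (hquasi s hs)).mono_left hU)
  exact ⟨p, hp, (tendsto_add_atTop_iff_nat 1).1 hlim⟩

end InertialKM

section Scheme

variable {H : Type*} [NormedAddCommGroup H] [InnerProductSpace ℝ H] [CompleteSpace H]
  {β ρ a lamLow lamUp σ δ : ℝ} {f : H → ℝ} {g : H → EReal} {α lam : ℕ → ℝ} {e₁ e₂ : ℕ → H}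
  {z : ℤ → H} {μ : ℕ → H}

-- The step `k = 0` is discarded: the estimates only involve `z k`, `k ≥ 0`, and `μ k`, `k ≥ 1`.
lemma IsScheme.isInertialKM (hz : IsScheme ρ f g α lam e₁ e₂ z μ) :
    IsInertialKM (fbOp ρ f g) (fun n => α (n + 1)) (fun n => lam (n + 1))
      (fun n => totalError ρ f g e₁ e₂ μ (n + 1)) (fun n => z n) (fun n => μ (n + 1)) where
  inertial n := by simpa using hz.inertial (n + 1)
  step n := by
    have hstep := hz.step (n + 1)
    rw [totalError, add_sub_cancel]
    convert hstep using 2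
    push_cast
    ring

lemma norm_totalError_le (hprox : LipschitzWith 1 (prox ρ g)) (hρ : 0 ≤ ρ) (k : ℕ) :
    ‖totalError ρ f g e₁ e₂ μ k‖ ≤ ρ * ‖e₁ k‖ + ‖e₂ k‖ := by
  set u := μ k - ρ • (∇ f (μ k) + e₁ k) with hu
  set v := μ k - ρ • ∇ f (μ k) with hv
  have huv : u - v = -(ρ • e₁ k) := by rw [hu, hv]; module
  have hprox_uv : ‖prox ρ g u - prox ρ g v‖ ≤ ρ * ‖e₁ k‖ := by
    simpa [huv, norm_smul, abs_of_nonneg hρ] using hprox.norm_sub_le u v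
  rw [totalError, fbOp, add_sub_right_comm]
  exact norm_add_le_of_le hprox_uv le_rfl

lemma summable_mul_norm_totalError (hprox : LipschitzWith 1 (prox ρ g)) (hρ : 0 ≤ ρ)
    {w : ℕ → ℝ} (hw : ∀ k, 0 ≤ w k) (h₁ : Summable fun k => w k * ‖e₁ k‖)
    (h₂ : Summable fun k => w k * ‖e₂ k‖) :
    Summable fun k => w k * ‖totalError ρ f g e₁ e₂ μ k‖ := by
  refine ((h₁.mul_left ρ).add h₂).of_nonneg_of_le
    (fun k => mul_nonneg (hw k) (norm_nonneg _)) fun k => ?_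
  calc w k * ‖totalError ρ f g e₁ e₂ μ k‖ ≤ w k * (ρ * ‖e₁ k‖ + ‖e₂ k‖) :=
        mul_le_mul_of_nonneg_left (norm_totalError_le hprox hρ k) (hw k)
    _ = ρ * (w k * ‖e₁ k‖) + w k * ‖e₂ k‖ := by ring

lemma ConditionI.kmCondition (hc : ConditionI β ρ α lam e₁ e₂ z a lamLow lamUp)
    (hprox : LipschitzWith 1 (prox ρ g)) (hρ : 0 ≤ ρ) :
    KMCondition ((4 * β - ρ) / (2 * β)) (fun n => α (n + 1)) (fun n => lam (n + 1))
      (fun n => totalError ρ f g e₁ e₂ μ (n + 1)) (fun n => z n) a lamLow lamUp where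
  inertia_bounds n := hc.inertia_bounds (n + 1)
  a_lt_one := hc.a_lt_one
  lamLow_pos := hc.lamLow_pos
  relax_bounds n := hc.relax_bounds (n + 1)
  lamUp_lt := hc.lamUp_lt
  summable_inertia := by simpa using (summable_nat_add_iff 1).2 hc.summable_inertia
  summable_error := (summable_nat_add_iff 1).2 <| summable_mul_norm_totalError hprox hρ
    (fun k => hc.lamLow_pos.le.trans (hc.relax_bounds k).1) hc.summable_e₁ hc.summable_e₂
  bounded := hc.bounded

lemma ConditionII.kmCondition {s : H} (hc : ConditionII β ρ α lam e₁ e₂ z a lamLow σ δ)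
    (hz : IsScheme ρ f g α lam e₁ e₂ z μ) (hprox : LipschitzWith 1 (prox ρ g)) (hρ : 0 ≤ ρ)
    (hκ : 0 < (4 * β - ρ) / (2 * β))
    (hquasi : IsQuasiAveragedAt ((4 * β - ρ) / (2 * β)) (fbOp ρ f g) s) :
    KMCondition ((4 * β - ρ) / (2 * β)) (fun n => α (n + 1)) (fun n => lam (n + 1))
      (fun n => totalError ρ f g e₁ e₂ μ (n + 1)) (fun n => z n) a lamLow (lamBar β ρ a σ δ) := by
  have hlam (n : ℕ) : 0 < lam n := hc.lamLow_pos.trans_le (hc.relax_bounds n).1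
  have herr : Summable fun n => ‖totalError ρ f g e₁ e₂ μ (n + 1)‖ := by
    simpa using (summable_nat_add_iff 1).2 (summable_mul_norm_totalError (w := fun _ => 1) (f := f)
      (μ := μ) hprox hρ (fun _ => zero_le_one) (by simpa using hc.summable_e₁)
      (by simpa using hc.summable_e₂))
  have hinertia : Summable fun n : ℕ => ‖z (n + 1 : ℕ) - z n‖ ^ 2 :=
    hz.isInertialKM.summable_sq_norm_sub hquasi (fun n => hc.inertia_bounds (n + 1))
      hc.a_lt_one.le (fun _ _ hmn => hc.inertia_mono (Nat.succ_le_succ hmn)) hc.σ_pos hc.δ_pos hκ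
      (fun n => hlam (n + 1)) (fun n => (hc.relax_bounds (n + 1)).2) herr hc.bounded
  have ha : 0 ≤ a := (hc.inertia_bounds 0).1.trans (hc.inertia_bounds 0).2
  exact
  { inertia_bounds := fun n => hc.inertia_bounds (n + 1)
    a_lt_one := hc.a_lt_one
    lamLow_pos := hc.lamLow_pos
    relax_bounds := fun n => hc.relax_bounds (n + 1)
    lamUp_lt := mul_lt_of_lt_one_right hκ (relaxRatio_lt_one ha hc.σ_pos hc.δ_pos)
    summable_inertia := hinertia.of_nonneg_of_le
      (fun n => mul_nonneg (hc.inertia_bounds _).1 (sq_nonneg _)) fun n =>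
        mul_le_of_le_one_left (sq_nonneg _) ((hc.inertia_bounds _).2.trans hc.a_lt_one.le)
    summable_error := (herr.mul_left (lamBar β ρ a σ δ)).of_nonneg_of_le
      (fun n => mul_nonneg (hlam _).le (norm_nonneg _)) fun n =>
        mul_le_mul_of_nonneg_right (hc.relax_bounds _).2 (norm_nonneg _)
    bounded := hc.bounded }

end Scheme

section Delta

variable {H : Type*} [NormedAddCommGroup H] {α lam : ℕ → ℝ} {z : ℤ → H}

lemma incrTerm_succ (s : H) (k : ℕ) :
    incrTerm z s (k + 1) = max (‖z (k + 1 : ℕ) - s‖ ^ 2 - ‖z k - s‖ ^ 2) 0 := by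
  simp only [incrTerm, Nat.cast_succ, add_sub_cancel_right]

lemma errTerm_succ (e : ℕ → H) (s : H) (k : ℕ) :
    errTerm lam e z s (k + 1) = 2 * ‖z (k + 2 : ℕ) - s‖ * lam (k + 1) * ‖e (k + 1)‖ := by
  simp only [errTerm, Nat.cast_succ]

lemma inertiaTerm_succ (k : ℕ) :
    inertiaTerm α z (k + 1) = α (k + 1) * (1 + α (k + 1)) * ‖z (k + 1 : ℕ) - z k‖ ^ 2 := by
  simp only [inertiaTerm, Nat.cast_succ, add_sub_cancel_right]

lemma delta_eq {a : ℝ} {e : ℕ → H} {s : H} (herr : Summable fun k => errTerm lam e z s (k + 1))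
    (hinertia : Summable fun k => inertiaTerm α z (k + 1)) :
    Delta a α lam e z s = a * ∑' k : ℕ, max (‖z (k + 1 : ℕ) - s‖ ^ 2 - ‖z k - s‖ ^ 2) 0
      + ∑' k, perturbation (fun n => α (n + 1)) (fun n => lam (n + 1)) (fun n => e (n + 1))
        (fun n => z n) s k := by
  rw [Delta, add_assoc, ← herr.tsum_add hinertia]
  simp only [incrTerm_succ, errTerm_succ, inertiaTerm_succ, perturbation]

end Delta

end InertialFB

theorem corollary4p2 {H : Type*} [NormedAddCommGroup H] [InnerProductSpace ℝ H] [CompleteSpace H]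
    (β ρ : ℝ) (hβ : 0 < β) (hρ : 0 < ρ) (hρβ : ρ < 2 * β)
    (f : H → ℝ) (hf_convex : ConvexOn ℝ Set.univ f) (hf_diff : Differentiable ℝ f)
    (hf_lip : ∀ x y, ‖∇ f x - ∇ f y‖ ≤ 1 / β * ‖x - y‖)
    (g : H → EReal) (hg_proper : InertialFB.IsProper g) (hg_convex : InertialFB.IsConvex g)
    (hg_lsc : LowerSemicontinuous g)
    (hΩ : (InertialFB.argmin (InertialFB.objective f g)).Nonempty)
    (α lam : ℕ → ℝ) (e₁ e₂ : ℕ → H) (z : ℤ → H) (μ : ℕ → H)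
    (hz : InertialFB.IsScheme ρ f g α lam e₁ e₂ z μ)
    (a lamLow θ : ℝ)
    (hcond : InertialFB.ConditionI β ρ α lam e₁ e₂ z a lamLow θ ∨
      ∃ σ δ : ℝ, InertialFB.ConditionII β ρ α lam e₁ e₂ z a lamLow σ δ ∧
        θ = InertialFB.lamBar β ρ a σ δ) :
    (∀ zs ∈ InertialFB.argmin (InertialFB.objective f g),
      ∃ l : ℝ, Tendsto (fun k : ℕ => ‖z k - zs‖) atTop (𝓝 l)) ∧
    (∃ zbar ∈ InertialFB.argmin (InertialFB.objective f g),
      Tendsto (fun k : ℕ => toWeakSpace ℝ H (z k)) atTop (𝓝 (toWeakSpace ℝ H zbar))) ∧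
    0 < (4 * β - ρ) / (2 * β) - θ ∧
    ∀ zs ∈ InertialFB.argmin (InertialFB.objective f g),
      Summable (fun k : ℕ => InertialFB.incrTerm z zs (k + 1)) ∧
      Summable (fun k : ℕ => InertialFB.errTerm lam
        (InertialFB.totalError ρ f g e₁ e₂ μ) z zs (k + 1)) ∧
      Summable (fun k : ℕ => InertialFB.inertiaTerm α z (k + 1)) ∧
      ∀ (k : ℕ) (hk : 1 ≤ k),
        (Finset.Icc 1 k).inf' (Finset.nonempty_Icc.mpr hk)
            (fun i => ‖InertialFB.fbOp ρ f g (μ i) - μ i‖ ^ 2)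
          ≤ 1 / (k * lamLow * ((4 * β - ρ) / (2 * β) - θ)) *
            (‖z 1 - zs‖ ^ 2 +
              InertialFB.Delta a α lam (InertialFB.totalError ρ f g e₁ e₂ μ) z zs) := by
  have hfix (s : H) := InertialFB.fbOp_eq_self_iff (p := s) hf_convex hf_diff hg_proper hg_convex
    hg_lsc hρ
  have hquasi (s : H) (hs : InertialFB.fbOp ρ f g s = s) :=
    InertialFB.isQuasiAveragedAt_fbOp hf_convex hf_diff hβ hf_lip hg_proper hg_convex hg_lsc hρ hs
  have hT := InertialFB.lipschitzWith_fbOp hf_convex hf_diff hβ hf_lip hg_proper hg_convex hg_lsc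
    hρ hρβ.le
  have hprox := InertialFB.lipschitzWith_prox hg_proper hg_convex hg_lsc hρ
  have hKM := hz.isInertialKM
  simp only [← hfix, Set.Nonempty] at hΩ ⊢
  obtain ⟨s₀, hs₀⟩ := hΩ
  have hc := hcond.elim (fun h => h.kmCondition (f := f) (μ := μ) hprox hρ.le)
    fun ⟨σ, δ, h, hθ⟩ => hθ ▸ h.kmCondition hz hprox hρ.le
      (div_pos (by linarith) (by linarith)) (hquasi s₀ hs₀)
  refine ⟨fun s hs => hKM.exists_tendsto_norm_sub hc (hquasi s hs),
    hKM.exists_tendsto_toWeakSpace hc hT hquasi ⟨s₀, hs₀⟩, sub_pos.2 hc.lamUp_lt, fun s hs => ?_⟩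
  have hincr := (hKM.summable_posPart hc (hquasi s hs)).congr fun k =>
    (InertialFB.incrTerm_succ s k).symm
  have herr := (hc.summable_errTerm s).congr fun k => (InertialFB.errTerm_succ _ s k).symm
  have hinertia := hc.summable_inertiaTerm.congr fun k => (InertialFB.inertiaTerm_succ k).symm
  refine ⟨hincr, herr, hinertia, fun k hk => ?_⟩
  rw [mul_assoc, InertialFB.delta_eq herr hinertia]
  exact InertialFB.inf'_Icc_le_of_sum_le hc.mul_gap_pos hk
    (hKM.sum_residual_le hc (hquasi s hs) k)
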